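/- **Model.** For positive integers write $[n]=\{0,\dots,n-1\}$. A quantum circuit with oracle access to $f:[M]\to[N]$ and space $S$ acts on $S$ qubits, initially in the state $|0\cdots0\rangle$, and is a fixed finite sequence (independent of $f$) of gates of three kinds: (i) arbitrary quantum operations (in particular, unitaries) on the $S$ qubits that do not depend on $f$; (ii) oracle gates $\mathcal O_f|x,p,w\rangle=e^{2i\pi\, p f(x)/N}|x,p,w\rangle$, where the query register $x\in[M]$ and the phase register $p\in[N]$ are held by $\lceil\log_2 M\rceil$ and $\lceil\log_2 N\rceil$ distinct qubits among the $S$ qubits and $w$ is the value of the other qubits (basis states that do not encode an element of $[M]\times[N]$ are unchanged); (iii) output gates, which write a pair in $[M]\times[M]$, or nothing, determined by the computational-basis value of the $S$ qubits, on fresh output qubits that may not be used later and are not counted in $S$. All outputs are measured in the computational basis at the end. The number $T$ of queries is the number of oracle gates. A *collision* of $f$ is a pair $(x_1,x_2)$ with $x_1\ne x_2$ and $f(x_1)=f(x_2)$; two collisions $(x_1,x_2)$, $(x_3,x_4)$ are *disjoint* if neither of $x_1,x_2$ equals $x_3$ or $x_4$. The circuit *finds $K$ disjoint collisions* in $f$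 if every pair it outputs is a collision of $f$ (the same collision may be output several times) and at least $K$ mutually disjoint collisions are among the output pairs. Its success probability is the probability of this event over a uniformly random function $f:[M]\to[N]$ and the measurement of the outputs. **Theorem.** There is an absolute constant $c>0$ such that for all positive integers $K,M,N$ with $1\le K\le N/8$ and all integers $S,T\ge 0$, every quantum circuit with space $S$ that makes $T$ queries and finds $K$ disjoint collisions in a uniformly random function $f:[M]\to[N]$ with success probability at least $2/3$ satisfies $$T^3 S\ \ge\ c\,K^3 N .$$ -/

import Mathlib

open scoped Matrix

/-- Computational basis states of a memory of `S` qubits. -/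
abbrev BasisState (S : ℕ) : Type := Fin S → Bool

/-- The natural number written in binary (least significant bit first) on the wires selected
by `e` in the basis state `b`. -/
def wireValue {k S : ℕ} (e : Fin k → Fin S) (b : BasisState S) : ℕ :=
  ∑ i : Fin k, if b (e i) then 2 ^ (i : ℕ) else 0

/-- The gates of a circuit that operates on `S` qubits and has oracle access to a function
`f : [M] → [N]`.
* `operation E`: an arbitrary quantum operation on the `S` qubits, independent of `f`, given by
  Kraus operators (a unitary gate is the case of a single Kraus operator; measurements and
  resets are other cases).
* `query e`: an oracle gate, whose query register (`⌈log₂ M⌉` qubits) and phase register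
  (`⌈log₂ N⌉` qubits) sit on pairwise distinct wires selected by `e`.
* `output r`: an output gate. On the basis state `b` it writes `r b`, which is a pair of elements
  of `[M]` or nothing, on fresh output qubits that are never used again and that are not part
  of the `S` qubits. -/
inductive OracleGate (M N S : ℕ) : Type
  | operation (k : ℕ) (E : Fin k → Matrix (BasisState S) (BasisState S) ℂ)
      (hE : ∑ i, (E i)ᴴ * E i = 1) : OracleGate M N S
  | query (e : Fin (Nat.clog 2 M) ⊕ Fin (Nat.clog 2 N) ↪ Fin S) : OracleGate M N S
  | output (r : BasisState S → Option (Fin M × Fin M)) : OracleGate M N S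

/-- A quantum circuit on `S` qubits: a finite sequence of gates, the first gate being the head
of the list. -/
abbrev OracleCircuit (M N S : ℕ) : Type := List (OracleGate M N S)

/-- Whether a gate is an oracle gate. -/
def OracleGate.isQuery {M N S : ℕ} : OracleGate M N S → Bool
  | .operation _ _ _ => false
  | .query _ => true
  | .output _ => false

/-- The number of queries made by a circuit. -/
def OracleCircuit.queryCount {M N S : ℕ} (C : OracleCircuit M N S) : ℕ :=
  C.countP OracleGate.isQuery

noncomputable section

/-- The phase `ω_N ^ (p * f x)`, with `ω_N = exp (2 * π * i / N)`, that the oracle gives to a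
basis state with `x ∈ [M]` in the query register and `p ∈ [N]` in the phase register. Basis
states whose registers do not encode an element of `[M] × [N]` are left unchanged. -/
def oraclePhase {M N S : ℕ} (e : Fin (Nat.clog 2 M) ⊕ Fin (Nat.clog 2 N) ↪ Fin S)
    (f : Fin M → Fin N) (b : BasisState S) : ℂ :=
  if h : wireValue (fun i => e (Sum.inl i)) b < M ∧ wireValue (fun i => e (Sum.inr i)) b < N then
    Complex.exp (2 * (Real.pi : ℂ) * Complex.I / (N : ℂ)) ^
      (wireValue (fun i => e (Sum.inr i)) b * (f ⟨wireValue (fun i => e (Sum.inl i)) b, h.1⟩ : ℕ))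
  else 1

/-- The oracle operator `O_f`. -/
def oracleMatrix {M N S : ℕ} (e : Fin (Nat.clog 2 M) ⊕ Fin (Nat.clog 2 N) ↪ Fin S)
    (f : Fin M → Fin N) : Matrix (BasisState S) (BasisState S) ℂ :=
  Matrix.diagonal (oraclePhase e f)

/-- The projector on the basis states for which an output gate `r` writes `o`. -/
def outputProjector {M S : ℕ} (r : BasisState S → Option (Fin M × Fin M))
    (o : Option (Fin M × Fin M)) : Matrix (BasisState S) (BasisState S) ℂ :=
  Matrix.diagonal fun b => if r b = o then 1 else 0

/-- Suppose that the memory is in the (subnormalized) state `ρ` and that the pairs in `out`, in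
this order, have already been output. Then `outputProb f A C ρ out` is the probability that, once
the circuit `C` has been run with oracle access to `f`, the list of all the output pairs
satisfies `A`. -/
def outputProb {M N S : ℕ} (f : Fin M → Fin N) (A : List (Fin M × Fin M) → Prop) :
    OracleCircuit M N S → Matrix (BasisState S) (BasisState S) ℂ → List (Fin M × Fin M) → ℝ
  | [], ρ, out => by
      classical
      exact if A out then ρ.trace.re else 0
  | .operation _ E _ :: C, ρ, out => outputProb f A C (∑ i, E i * ρ * (E i)ᴴ) out
  | .query e :: C, ρ, out => outputProb f A C (oracleMatrix e f * ρ * (oracleMatrix e f)ᴴ) out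
  | .output r :: C, ρ, out =>
      ∑ o : Option (Fin M × Fin M),
        outputProb f A C (outputProjector r o * ρ * outputProjector r o) (out ++ o.toList)

/-- The initial memory state `|0…0⟩⟨0…0|`. -/
def initialState (S : ℕ) : Matrix (BasisState S) (BasisState S) ℂ :=
  Matrix.single (fun _ => false) (fun _ => false) 1

/-- A collision of `f`. -/
def IsCollision {M N : ℕ} (f : Fin M → Fin N) (z : Fin M × Fin M) : Prop :=
  z.1 ≠ z.2 ∧ f z.1 = f z.2

/-- Two pairs without common element. -/
def DisjointPairs {M : ℕ} (z z' : Fin M × Fin M) : Prop :=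
  z.1 ≠ z'.1 ∧ z.1 ≠ z'.2 ∧ z.2 ≠ z'.1 ∧ z.2 ≠ z'.2

/-- The output is correct: everything that was output is a collision of `f` (repetitions are
allowed), and at least `K` mutually disjoint collisions were output. -/
def FindsDisjointCollisions {M N : ℕ} (K : ℕ) (f : Fin M → Fin N)
    (out : List (Fin M × Fin M)) : Prop :=
  (∀ z ∈ out, IsCollision f z) ∧
    ∃ s : Finset (Fin M × Fin M), s.card = K ∧ (∀ z ∈ s, z ∈ out) ∧
      (s : Set (Fin M × Fin M)).Pairwise DisjointPairs

/-- The probability, over a uniformly random `f : [M] → [N]` and the outputs of the circuit, that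
the circuit finds `K` disjoint collisions of `f`. -/
def OracleCircuit.successProb {M N S : ℕ} (K : ℕ) (C : OracleCircuit M N S) : ℝ :=
  (∑ f : Fin M → Fin N, outputProb f (FindsDisjointCollisions K f) C (initialState S) []) /
    (N : ℝ) ^ M

end

/-! ### Output probabilities as positive linear functionals of the memory state. -/

open scoped ComplexOrder
set_option linter.unusedSectionVars false

/-! Time is cut into blocks of few queries. A circuit that outputs more than `L * k` disjoint
collisions in `L` blocks outputs more than `k` in some block. The memory at the start of a block
depends on `f`, but it is dominated by the identity, which is `2 ^ S` times the maximally mixed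
state: forgetting this dependence costs only a factor `2 ^ S` (`outputProb_append_le`,
`sum_outputProb_le_of_blocks`). So a bound for one block that is exponentially small in the number
of collisions suffices.

That bound (`sum_outputProb_le`) comes from recording the queries. The random `f` is purified by one
register per input, in uniform superposition. The change of basis `exchange` turns this
superposition into `none`, so the database starts empty and a query acts on one entry. Progress is
the surplus of entries over distinct values. To raise it, a query must write one of the at most `t`
values already recorded, which has squared amplitude `O(t / N)` (`sum_surplus_norm_sq_localOp_le`).
By Pascal's rule, surplus `k` after `T` queries has amplitude at most `T.choose k * ε ^ k` with `ε ^
2 = 13 * T / N` (`ProgressBound.query`).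

Conversely, let `2 * k - 1` disjoint pairs be output. A database of surplus below `k` records fewer
than `k` of them (`card_filter_records_lt`), and each of the others is a collision with weight only
`O(1 / N)` (`sum_forall_records_norm_sq_le`). Altogether the success probability is at most `(c * T
^ 3 / (k ^ 2 * N)) ^ k + (256 / N) ^ k`.

With `k = S`, blocks of about `(S ^ 2 * N) ^ (1/3)` queries are too short to find `2 * S - 1`
collisions. About `K / S` of them are needed, which gives the tradeoff. If `K ≤ 4 * S`, one uncut
block with `k` about `K / 2` is enough. -/

theorem trace_mul_conjTranspose_sum {n ι : Type*} [Fintype n] [DecidableEq n] [Fintype ι]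
    (E : ι → Matrix n n ℂ) (hE : ∑ i, (E i)ᴴ * E i = 1) (ρ : Matrix n n ℂ) :
    (∑ i, E i * ρ * (E i)ᴴ).trace = ρ.trace := by
  have h : ∀ i, (E i * ρ * (E i)ᴴ).trace = ((E i)ᴴ * E i * ρ).trace := fun i => by
    rw [Matrix.trace_mul_comm, ← Matrix.mul_assoc]
  rw [Matrix.trace_sum, Finset.sum_congr rfl fun i _ => h i, ← Matrix.trace_sum,
    ← Finset.sum_mul, hE, one_mul]

theorem norm_exp_root_pow (N a : ℕ) :
    ‖Complex.exp (2 * (Real.pi : ℂ) * Complex.I / (N : ℂ)) ^ a‖ = 1 := by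
  have : (2 * (Real.pi : ℂ) * Complex.I / (N : ℂ)) = ((2 * Real.pi / N : ℝ) : ℂ) * Complex.I := by
    push_cast; ring
  rw [norm_pow, this, Complex.norm_exp_ofReal_mul_I, one_pow]

theorem norm_oraclePhase {M N S : ℕ} (e : Fin (Nat.clog 2 M) ⊕ Fin (Nat.clog 2 N) ↪ Fin S)
    (f : Fin M → Fin N) (b : BasisState S) : ‖oraclePhase e f b‖ = 1 := by
  unfold oraclePhase
  split_ifs with h
  · exact norm_exp_root_pow _ _
  · simp

theorem oracleMatrix_conjTranspose_mul {M N S : ℕ}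
    (e : Fin (Nat.clog 2 M) ⊕ Fin (Nat.clog 2 N) ↪ Fin S) (f : Fin M → Fin N) :
    (oracleMatrix e f)ᴴ * oracleMatrix e f = 1 := by
  unfold oracleMatrix
  rw [Matrix.diagonal_conjTranspose, Matrix.diagonal_mul_diagonal, ← Matrix.diagonal_one]
  congr 1
  funext b
  have := Complex.conj_mul' (oraclePhase e f b)
  rw [norm_oraclePhase] at this
  simpa using this

theorem outputProjector_conjTranspose {M S : ℕ} (r : BasisState S → Option (Fin M × Fin M))
    (o : Option (Fin M × Fin M)) : (outputProjector r o)ᴴ = outputProjector r o := by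
  unfold outputProjector
  rw [Matrix.diagonal_conjTranspose]
  congr 1
  funext b
  simp only [Pi.star_apply]
  split_ifs <;> simp

theorem sum_outputProjector_mul {M S : ℕ} (r : BasisState S → Option (Fin M × Fin M)) :
    ∑ o, (outputProjector r o)ᴴ * outputProjector r o = 1 := by
  ext b b'
  simp only [outputProjector_conjTranspose]
  simp only [outputProjector, Matrix.diagonal_mul_diagonal, Matrix.sum_apply,
    Matrix.diagonal_apply, Matrix.one_apply]
  by_cases h : b = b' <;> simp [h]

theorem trace_oracleMatrix_conj {M N S : ℕ}
    (e : Fin (Nat.clog 2 M) ⊕ Fin (Nat.clog 2 N) ↪ Fin S) (f : Fin M → Fin N)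
    (ρ : Matrix (BasisState S) (BasisState S) ℂ) :
    (oracleMatrix e f * ρ * (oracleMatrix e f)ᴴ).trace = ρ.trace := by
  rw [Matrix.trace_mul_comm, ← Matrix.mul_assoc, oracleMatrix_conjTranspose_mul, one_mul]

theorem sum_trace_outputProjector_conj {M S : ℕ} (r : BasisState S → Option (Fin M × Fin M))
    (ρ : Matrix (BasisState S) (BasisState S) ℂ) :
    ∑ o, (outputProjector r o * ρ * outputProjector r o).trace.re = ρ.trace.re := by
  have h := trace_mul_conjTranspose_sum _ (sum_outputProjector_mul r) ρ
  simp only [outputProjector_conjTranspose] at h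
  rw [← h, Matrix.trace_sum, Complex.re_sum]

theorem outputProjector_conj_posSemidef {M S : ℕ} (r : BasisState S → Option (Fin M × Fin M))
    (o : Option (Fin M × Fin M)) {ρ : Matrix (BasisState S) (BasisState S) ℂ}
    (hρ : ρ.PosSemidef) : (outputProjector r o * ρ * outputProjector r o).PosSemidef := by
  simpa only [outputProjector_conjTranspose] using
    hρ.mul_mul_conjTranspose_same (outputProjector r o)

theorem kraus_posSemidef {n ι : Type*} [Fintype n] [Fintype ι] (E : ι → Matrix n n ℂ)
    {ρ : Matrix n n ℂ} (hρ : ρ.PosSemidef) : (∑ i, E i * ρ * (E i)ᴴ).PosSemidef :=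
  Matrix.posSemidef_sum _ fun i _ => hρ.mul_mul_conjTranspose_same (E i)

theorem trace_re_nonneg {n : Type*} [Fintype n] {ρ : Matrix n n ℂ} (hρ : ρ.PosSemidef) :
    0 ≤ ρ.trace.re := (Complex.nonneg_iff.mp hρ.trace_nonneg).1

section outputProb

variable {M N S : ℕ} (f : Fin M → Fin N)

theorem outputProb_add (A : List (Fin M × Fin M) → Prop) (C : OracleCircuit M N S)
    (ρ σ : Matrix (BasisState S) (BasisState S) ℂ) (out : List (Fin M × Fin M)) :
    outputProb f A C (ρ + σ) out = outputProb f A C ρ out + outputProb f A C σ out := by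
  induction C generalizing ρ σ out with
  | nil => simp only [outputProb]; split_ifs <;> simp
  | cons g C ih =>
    cases g <;> simp only [outputProb, Matrix.mul_add, Matrix.add_mul, Finset.sum_add_distrib, ih]

theorem outputProb_smul (A : List (Fin M × Fin M) → Prop) (C : OracleCircuit M N S) (c : ℝ)
    (ρ : Matrix (BasisState S) (BasisState S) ℂ) (out : List (Fin M × Fin M)) :
    outputProb f A C ((c : ℂ) • ρ) out = c * outputProb f A C ρ out := by
  induction C generalizing ρ out with
  | nil => simp only [outputProb]; split_ifs <;> simp
  | cons g C ih =>
    cases g <;> simp only [outputProb, Matrix.mul_smul, Matrix.smul_mul, ← Finset.smul_sum, ih,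
      Finset.mul_sum]

theorem outputProb_sum {ι : Type*} (A : List (Fin M × Fin M) → Prop) (C : OracleCircuit M N S)
    (s : Finset ι) (ρ : ι → Matrix (BasisState S) (BasisState S) ℂ)
    (out : List (Fin M × Fin M)) :
    outputProb f A C (∑ i ∈ s, ρ i) out = ∑ i ∈ s, outputProb f A C (ρ i) out := by
  classical
  induction s using Finset.induction_on with
  | empty =>
    have := outputProb_smul f A C 0 0 out
    simpa using this
  | insert a s ha ih => rw [Finset.sum_insert ha, Finset.sum_insert ha, outputProb_add, ih]

theorem outputProb_nonneg (A : List (Fin M × Fin M) → Prop) (C : OracleCircuit M N S)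
    {ρ : Matrix (BasisState S) (BasisState S) ℂ} (hρ : ρ.PosSemidef)
    (out : List (Fin M × Fin M)) : 0 ≤ outputProb f A C ρ out := by
  induction C generalizing ρ out with
  | nil =>
    simp only [outputProb]
    split_ifs
    exacts [trace_re_nonneg hρ, le_rfl]
  | cons g C ih =>
    cases g with
    | operation k E hE => exact ih (kraus_posSemidef E hρ) _
    | query e => exact ih (hρ.mul_mul_conjTranspose_same _) _
    | output r => exact Finset.sum_nonneg fun o _ => ih (outputProjector_conj_posSemidef r o hρ) _

theorem outputProb_le_trace (A : List (Fin M × Fin M) → Prop) (C : OracleCircuit M N S)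
    {ρ : Matrix (BasisState S) (BasisState S) ℂ} (hρ : ρ.PosSemidef)
    (out : List (Fin M × Fin M)) : outputProb f A C ρ out ≤ ρ.trace.re := by
  induction C generalizing ρ out with
  | nil =>
    simp only [outputProb]
    split_ifs
    exacts [le_rfl, trace_re_nonneg hρ]
  | cons g C ih =>
    cases g with
    | operation k E hE =>
      exact (ih (kraus_posSemidef E hρ) _).trans_eq (by rw [trace_mul_conjTranspose_sum E hE])
    | query e =>
      exact (ih (hρ.mul_mul_conjTranspose_same _) _).trans_eq (by rw [trace_oracleMatrix_conj])
    | output r =>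
      rw [← sum_trace_outputProjector_conj r ρ]
      exact Finset.sum_le_sum fun o _ => ih (outputProjector_conj_posSemidef r o hρ) _

/-- The two prefixes may differ, so that a block can forget what earlier blocks have output. -/
theorem outputProb_mono_event {A A' : List (Fin M × Fin M) → Prop} (C : OracleCircuit M N S)
    {ρ : Matrix (BasisState S) (BasisState S) ℂ} (hρ : ρ.PosSemidef)
    (out out' : List (Fin M × Fin M)) (h : ∀ l, A (out ++ l) → A' (out' ++ l)) :
    outputProb f A C ρ out ≤ outputProb f A' C ρ out' := by
  induction C generalizing ρ out out' with
  | nil =>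
    simp only [outputProb]
    have h0 := h []
    simp only [List.append_nil] at h0
    split_ifs with h1 h2
    exacts [le_rfl, absurd (h0 h1) h2, trace_re_nonneg hρ, le_rfl]
  | cons g C ih =>
    cases g with
    | operation k E hE => exact ih (kraus_posSemidef E hρ) _ _ h
    | query e => exact ih (hρ.mul_mul_conjTranspose_same _) _ _ h
    | output r =>
      refine Finset.sum_le_sum fun o _ => ih (outputProjector_conj_posSemidef r o hρ) _ _ ?_
      intro l
      simpa only [List.append_assoc] using h (o.toList ++ l)

theorem outputProb_mono_state (A : List (Fin M × Fin M) → Prop) (C : OracleCircuit M N S)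
    {ρ σ : Matrix (BasisState S) (BasisState S) ℂ} (h : (σ - ρ).PosSemidef)
    (out : List (Fin M × Fin M)) : outputProb f A C ρ out ≤ outputProb f A C σ out := by
  have := outputProb_add f A C ρ (σ - ρ) out
  rw [add_sub_cancel] at this
  linarith [outputProb_nonneg f A C h out]

end outputProb

/-! ### Cutting a circuit into blocks. -/

/-- The eigenvalues are nonnegative and add up to the trace, so none exceeds it. This replaces a
memory state that depends on `f` by one that does not. -/
theorem trace_smul_one_sub_posSemidef {n : Type*} [Fintype n] [DecidableEq n]
    {ρ : Matrix n n ℂ} (hρ : ρ.PosSemidef) :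
    (((ρ.trace.re : ℝ) : ℂ) • (1 : Matrix n n ℂ) - ρ).PosSemidef := by
  have hH := hρ.isHermitian
  set U : Matrix n n ℂ := hH.eigenvectorUnitary.1 with hU
  have hUU : U * Uᴴ = 1 := by
    have := (Matrix.mem_unitaryGroup_iff).1 hH.eigenvectorUnitary.2
    simpa [Matrix.star_eq_conjTranspose] using this
  have hs : ρ = U * Matrix.diagonal (fun i => (hH.eigenvalues i : ℂ)) * Uᴴ := by
    have := hH.spectral_theorem
    simpa [Unitary.conjStarAlgAut_apply, Matrix.star_eq_conjTranspose, Function.comp_def] using this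
  have ht : ρ.trace.re = ∑ i, hH.eigenvalues i := by
    rw [hH.trace_eq_sum_eigenvalues]; simp
  have key : ((ρ.trace.re : ℝ) : ℂ) • (1 : Matrix n n ℂ) - ρ =
      U * Matrix.diagonal (fun i => ((ρ.trace.re - hH.eigenvalues i : ℝ) : ℂ)) * Uᴴ := by
    have hd : Matrix.diagonal (fun i => ((ρ.trace.re - hH.eigenvalues i : ℝ) : ℂ)) =
        ((ρ.trace.re : ℝ) : ℂ) • (1 : Matrix n n ℂ) -
          Matrix.diagonal (fun i => (hH.eigenvalues i : ℂ)) := by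
      ext i j
      by_cases h : i = j <;> simp [h]
    rw [hd, Matrix.mul_sub, Matrix.sub_mul, ← hs, Matrix.mul_smul, Matrix.smul_mul, Matrix.mul_one,
      hUU]
  rw [key]
  refine Matrix.PosSemidef.mul_mul_conjTranspose_same ?_ U
  refine Matrix.PosSemidef.diagonal fun i => ?_
  simp only [Pi.zero_apply]
  rw [Complex.zero_le_real, ht, sub_nonneg]
  exact Finset.single_le_sum (fun j _ => hρ.eigenvalues_nonneg j) (Finset.mem_univ i)

theorem FindsDisjointCollisions.mono {M N K K' : ℕ} {f : Fin M → Fin N}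
    {out : List (Fin M × Fin M)} (h : FindsDisjointCollisions K f out) (hK : K' ≤ K) :
    FindsDisjointCollisions K' f out := by
  obtain ⟨h1, s, hs, hso, hp⟩ := h
  obtain ⟨t, hts, ht⟩ := Finset.exists_subset_card_eq (hs ▸ hK)
  exact ⟨h1, t, ht, fun z hz => hso z (hts hz), hp.mono (by exact_mod_cast hts)⟩

/-- At most `K₁` of the disjoint pairs already occur in `out`; all others must come from `l`. -/
theorem FindsDisjointCollisions.of_append {M N K₁ K₂ : ℕ} {f : Fin M → Fin N}
    {out l : List (Fin M × Fin M)} (h : FindsDisjointCollisions (K₁ + K₂) f (out ++ l))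
    (hout : ¬ FindsDisjointCollisions (K₁ + 1) f out) : FindsDisjointCollisions K₂ f l := by
  classical
  obtain ⟨h1, s, hs, hso, hp⟩ := h
  set s₁ := s.filter (· ∈ out) with hs₁
  set s₂ := s.filter (¬ · ∈ out) with hs₂
  have hsum : s₁.card + s₂.card = s.card := Finset.card_filter_add_card_filter_not _
  have hlt : s₁.card < K₁ + 1 := by
    by_contra hge
    refine hout (FindsDisjointCollisions.mono (K := s₁.card) ⟨fun z hz => h1 z (by simp [hz]), s₁,
      rfl, fun z hz => (Finset.mem_filter.1 hz).2, hp.mono ?_⟩ (not_lt.1 hge))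
    exact_mod_cast Finset.filter_subset _ _
  refine FindsDisjointCollisions.mono (K := s₂.card) ⟨fun z hz => h1 z (by simp [hz]), s₂, rfl,
    fun z hz => ?_, hp.mono (by exact_mod_cast Finset.filter_subset _ _)⟩ (by omega)
  rw [hs₂, Finset.mem_filter] at hz
  exact (List.mem_append.1 (hso z hz.1)).resolve_left hz.2

section append

variable {M N S : ℕ} (f : Fin M → Fin N)

/-- Once `C₁` has output `K₁ + 1` disjoint collisions, the first term pays for everything. Otherwise
`C₂` must find `K₂` by itself, from a state dominated by its trace times the identity. -/
theorem outputProb_append_le (K₁ K₂ : ℕ) (C₁ C₂ : OracleCircuit M N S)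
    {ρ : Matrix (BasisState S) (BasisState S) ℂ} (hρ : ρ.PosSemidef)
    (out : List (Fin M × Fin M)) :
    outputProb f (FindsDisjointCollisions (K₁ + K₂) f) (C₁ ++ C₂) ρ out ≤
      outputProb f (FindsDisjointCollisions (K₁ + 1) f) C₁ ρ out +
        ρ.trace.re * outputProb f (FindsDisjointCollisions K₂ f) C₂ 1 [] := by
  induction C₁ generalizing ρ out with
  | nil =>
    rw [List.nil_append]
    conv_rhs => rw [outputProb]
    have hone : (1 : Matrix (BasisState S) (BasisState S) ℂ).PosSemidef := Matrix.PosSemidef.one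
    split_ifs with h
    · exact (outputProb_le_trace f _ _ hρ _).trans (le_add_of_nonneg_right
        (mul_nonneg (trace_re_nonneg hρ) (outputProb_nonneg f _ _ hone _)))
    · rw [zero_add, ← outputProb_smul]
      exact (outputProb_mono_event f C₂ hρ out [] fun l hl => hl.of_append h).trans
        (outputProb_mono_state f _ _ (trace_smul_one_sub_posSemidef hρ) _)
  | cons g C ih =>
    cases g with
    | operation k E hE =>
      have := ih (kraus_posSemidef E hρ) out
      rwa [trace_mul_conjTranspose_sum E hE] at this
    | query e =>
      have := ih (hρ.mul_mul_conjTranspose_same (oracleMatrix e f)) out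
      rwa [trace_oracleMatrix_conj] at this
    | output r =>
      simp only [List.cons_append, outputProb]
      rw [← sum_trace_outputProjector_conj r ρ, Finset.sum_mul, ← Finset.sum_add_distrib]
      exact Finset.sum_le_sum fun o _ => ih (outputProjector_conj_posSemidef r o hρ) _

end append

theorem OracleCircuit.exists_append_of_queryCount_le {M N S : ℕ} (C : OracleCircuit M N S)
    (a b : ℕ) (h : C.queryCount ≤ a + b) :
    ∃ C₁ C₂ : OracleCircuit M N S, C = C₁ ++ C₂ ∧ C₁.queryCount ≤ a ∧ C₂.queryCount ≤ b := by
  induction C generalizing a with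
  | nil => exact ⟨[], [], rfl, by simp [queryCount], by simp [queryCount]⟩
  | cons g C ih =>
    by_cases hg : g.isQuery = true
    · have h' : OracleCircuit.queryCount C + 1 ≤ a + b := by
        simpa [queryCount, List.countP_cons, hg] using h
      cases a with
      | zero =>
        exact ⟨[], g :: C, rfl, by simp [queryCount], by simpa using h⟩
      | succ a =>
        obtain ⟨C₁, C₂, rfl, h1, h2⟩ := ih a (by omega)
        refine ⟨g :: C₁, C₂, rfl, ?_, h2⟩
        simpa [queryCount, List.countP_cons, hg] using h1
    · have h' : OracleCircuit.queryCount C ≤ a + b := by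
        simpa [queryCount, List.countP_cons, hg] using h
      obtain ⟨C₁, C₂, rfl, h1, h2⟩ := ih a h'
      refine ⟨g :: C₁, C₂, rfl, ?_, h2⟩
      simpa [queryCount, List.countP_cons, hg] using h1

/-- If a circuit is cut into `L` blocks of at most `t` queries, then it can find more than `L * k`
disjoint collisions only if some block finds more than `k` of them. -/
theorem sum_outputProb_le_of_blocks {M N S : ℕ} (t k : ℕ) {δ : ℝ}
    (hδ : ∀ C : OracleCircuit M N S, C.queryCount ≤ t →
      ∑ f : Fin M → Fin N, outputProb f (FindsDisjointCollisions (k + 1) f) C 1 [] ≤ δ)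
    (L : ℕ) (C : OracleCircuit M N S) (hC : C.queryCount ≤ (L + 1) * t)
    {ρ : Matrix (BasisState S) (BasisState S) ℂ} (hρ : ρ.PosSemidef) (htr : ρ.trace.re = 1) :
    ∑ f : Fin M → Fin N, outputProb f (FindsDisjointCollisions ((L + 1) * k + 1) f) C ρ [] ≤
      (L + 1) * δ := by
  induction L generalizing C with
  | zero =>
    have hρ1 := trace_smul_one_sub_posSemidef hρ
    rw [htr, Complex.ofReal_one, one_smul] at hρ1
    simp only [zero_add, one_mul, Nat.cast_zero] at hC ⊢
    exact (Finset.sum_le_sum fun f _ => outputProb_mono_state f _ C hρ1 []).trans (hδ C hC)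
  | succ L ih =>
    obtain ⟨C₁, C₂, rfl, h1, h2⟩ := C.exists_append_of_queryCount_le ((L + 1) * t) t
      (by rw [add_one_mul (L + 1)] at hC; exact hC)
    have key : ∀ f : Fin M → Fin N,
        outputProb f (FindsDisjointCollisions ((L + 1 + 1) * k + 1) f) (C₁ ++ C₂) ρ [] ≤
        outputProb f (FindsDisjointCollisions ((L + 1) * k + 1) f) C₁ ρ [] +
          outputProb f (FindsDisjointCollisions (k + 1) f) C₂ 1 [] := fun f => by
      have := outputProb_append_le f ((L + 1) * k) (k + 1) C₁ C₂ hρ []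
      rw [htr, one_mul] at this
      rwa [add_one_mul (L + 1), add_assoc]
    refine (Finset.sum_le_sum fun f _ => key f).trans ?_
    rw [Finset.sum_add_distrib]
    have := add_le_add (ih C₁ h1) (hδ C₂ h2)
    push_cast
    linarith

theorem initialState_posSemidef (S : ℕ) : (initialState S).PosSemidef := by
  have : initialState S = Matrix.vecMulVec (Pi.single (fun _ => false) 1)
      (star (Pi.single (fun _ => false) 1)) := by
    ext i j
    simp [initialState, Matrix.single_apply, Matrix.vecMulVec_apply, Pi.single_apply, eq_comm]
    grind
  rw [this]
  exact Matrix.posSemidef_vecMulVec_self_star _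

theorem trace_initialState (S : ℕ) : (initialState S).trace.re = 1 := by
  simp [initialState]

/-! ### Circuits without queries. -/

/-- Overwriting the value at `x` is injective here: the lost value is still stored at `y`. -/
theorem card_filter_eq_mul_le {M N : ℕ} (x y : Fin M) (hxy : x ≠ y) :
    (Finset.univ.filter fun f : Fin M → Fin N => f x = f y).card * N ≤ N ^ M := by
  have h : N ^ M = (Finset.univ : Finset (Fin M → Fin N)).card := by simp
  have h' : (Finset.univ.filter fun f : Fin M → Fin N => f x = f y).card * N =
      ((Finset.univ.filter fun f : Fin M → Fin N => f x = f y) ×ˢ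
        (Finset.univ : Finset (Fin N))).card := by
    rw [Finset.card_product, Finset.card_univ, Fintype.card_fin]
  rw [h, h']
  refine Finset.card_le_card_of_injOn (fun p => Function.update p.1 x p.2) (fun _ _ => by simp) ?_
  rintro ⟨f, a⟩ hf ⟨g, b⟩ hg h
  simp only [Finset.coe_product, Finset.coe_filter, Finset.mem_univ, true_and, Finset.coe_univ,
    Set.mem_prod, Set.mem_ofPred_eq, Set.mem_univ, and_true] at hf hg h
  have hne : ∀ z, z ≠ x → f z = g z := fun z hz => by
    have := congrFun h z
    rwa [Function.update_of_ne hz, Function.update_of_ne hz] at this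
  have hx : f x = g x := by rw [hf, hg, hne y hxy.symm]
  refine Prod.ext (funext fun z => ?_) ?_
  · rcases eq_or_ne z x with rfl | hz
    exacts [hx, hne z hz]
  · simpa using congrFun h x

/-- Without queries a circuit finds a collision with probability at most `1 / N`. -/
theorem sum_outputProb_le_of_queryCount_eq_zero {M N S K : ℕ} (hK : 1 ≤ K)
    (C : OracleCircuit M N S) (hC : C.queryCount = 0)
    {ρ : Matrix (BasisState S) (BasisState S) ℂ} (hρ : ρ.PosSemidef)
    (out : List (Fin M × Fin M)) :
    (∑ f : Fin M → Fin N, outputProb f (FindsDisjointCollisions K f) C ρ out) * N ≤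
      (N : ℝ) ^ M * ρ.trace.re := by
  classical
  induction C generalizing ρ out with
  | nil =>
    have h0 := trace_re_nonneg hρ
    simp only [outputProb]
    -- One output pair with distinct entries must be a collision of an unknown function. Without
    -- such a pair there is no success, because `K ≥ 1`.
    by_cases hout : ∃ z ∈ out, z.1 ≠ z.2
    · obtain ⟨z, hz, hne⟩ := hout
      have hle : ∀ f : Fin M → Fin N,
          (if FindsDisjointCollisions K f out then ρ.trace.re else 0) ≤
          if f z.1 = f z.2 then ρ.trace.re else 0 := fun f => by
        split_ifs with h1 h2
        exacts [le_rfl, absurd (h1.1 z hz).2 h2, h0, le_rfl]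
      refine (mul_le_mul_of_nonneg_right (Finset.sum_le_sum fun f _ => hle f)
        (Nat.cast_nonneg _)).trans ?_
      rw [← Finset.sum_filter, Finset.sum_const, nsmul_eq_mul, mul_right_comm]
      refine mul_le_mul_of_nonneg_right ?_ h0
      exact_mod_cast card_filter_eq_mul_le z.1 z.2 hne
    · have : ∀ f : Fin M → Fin N, ¬ FindsDisjointCollisions K f out := fun f hf => by
        obtain ⟨h1, s, hs, hso, -⟩ := hf
        obtain ⟨z, hz⟩ := Finset.card_pos.1 (hs ▸ hK)
        exact hout ⟨z, hso z hz, (h1 z (hso z hz)).1⟩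
      simp only [this, if_false, Finset.sum_const_zero, zero_mul]
      positivity
  | cons g C ih =>
    cases g with
    | operation k E hE =>
      have := ih (by simpa [OracleCircuit.queryCount, OracleGate.isQuery] using hC)
        (kraus_posSemidef E hρ) out
      rwa [trace_mul_conjTranspose_sum E hE] at this
    | query e => simp [OracleCircuit.queryCount, OracleGate.isQuery] at hC
    | output r =>
      simp only [outputProb]
      rw [← sum_trace_outputProjector_conj r ρ, Finset.sum_comm, Finset.sum_mul, Finset.mul_sum]
      exact Finset.sum_le_sum fun o _ =>
        ih (by simpa [OracleCircuit.queryCount, OracleGate.isQuery] using hC)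
          (outputProjector_conj_posSemidef r o hρ) _

/-! ### Operators on one register and the recording basis. -/

noncomputable section LocalOperators

variable {X Y : Type*} [Fintype X] [DecidableEq X] [Fintype Y] [DecidableEq Y]

/-- The operator on functions of a database `D : X → Option Y` that acts by the matrix `m` on
the register of `x`. -/
def localOp (x : X) (m : Matrix (Option Y) (Option Y) ℂ) :
    Module.End ℂ ((X → Option Y) → ℂ) where
  toFun v D := ∑ d, m (D x) d * v (Function.update D x d)
  map_add' v w := by
    funext D
    simp [mul_add, Finset.sum_add_distrib]
  map_smul' c v := by
    funext D
    simp only [Pi.smul_apply, smul_eq_mul, RingHom.id_apply, Finset.mul_sum, mul_left_comm c]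

theorem localOp_apply (x : X) (m : Matrix (Option Y) (Option Y) ℂ) (v : (X → Option Y) → ℂ)
    (D : X → Option Y) : localOp x m v D = ∑ d, m (D x) d * v (Function.update D x d) := rfl

theorem localOp_update (x : X) (m : Matrix (Option Y) (Option Y) ℂ) (v : (X → Option Y) → ℂ)
    (D : X → Option Y) (c : Option Y) :
    localOp x m v (Function.update D x c) = (m *ᵥ fun d => v (Function.update D x d)) c := by
  simp [localOp_apply, Matrix.mulVec, dotProduct]

theorem localOp_mul (x : X) (m m' : Matrix (Option Y) (Option Y) ℂ) :
    localOp x m * localOp x m' = localOp (X := X) x (m * m') := by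
  refine LinearMap.ext fun v => funext fun D => ?_
  simp only [Module.End.mul_apply, localOp_apply, Function.update_self, Function.update_idem,
    Matrix.mul_apply, Finset.mul_sum, Finset.sum_mul]
  rw [Finset.sum_comm]
  simp only [mul_assoc]

theorem localOp_one (x : X) : localOp x (1 : Matrix (Option Y) (Option Y) ℂ) = 1 := by
  refine LinearMap.ext fun v => funext fun D => ?_
  simp [localOp_apply, Matrix.one_apply]

theorem localOp_commute {x x' : X} (h : x ≠ x') (m m' : Matrix (Option Y) (Option Y) ℂ) :
    Commute (localOp x m) (localOp x' m') := by
  refine LinearMap.ext fun v => funext fun D => ?_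
  simp only [Module.End.mul_apply, localOp_apply, Function.update_of_ne h,
    Function.update_of_ne h.symm, Finset.mul_sum]
  rw [Finset.sum_comm]
  refine Finset.sum_congr rfl fun d _ => Finset.sum_congr rfl fun d' _ => ?_
  rw [Function.update_comm h, mul_left_comm]

/-- Exchanging the new entry with the one it overwrites is an involution of the pairs `(D, d)`. -/
theorem sum_sum_update {R : Type*} [NonAssocSemiring R] (x : X) (h : (X → Option Y) → R) :
    ∑ D, ∑ d, h (Function.update D x d) = Fintype.card (Option Y) * ∑ D, h D := by
  rw [← Fintype.sum_prod_type' (f := fun D d => h (Function.update D x d))]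
  let e : (X → Option Y) × Option Y ≃ (X → Option Y) × Option Y :=
    { toFun := fun p => (Function.update p.1 x p.2, p.1 x)
      invFun := fun p => (Function.update p.1 x p.2, p.1 x)
      left_inv := fun p => by simp
      right_inv := fun p => by simp }
  have he : ∑ p : (X → Option Y) × Option Y, h (Function.update p.1 x p.2) =
      ∑ p : (X → Option Y) × Option Y, h p.1 := Fintype.sum_equiv e _ _ fun p => rfl
  rw [he, Fintype.sum_prod_type]
  simp [Finset.mul_sum]

/-- An inequality may be checked on each fibre of one register, where a local operator is just a
matrix. -/
theorem sum_le_sum_of_update (x : X) {h h' : (X → Option Y) → ℝ}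
    (H : ∀ D, ∑ d, h (Function.update D x d) ≤ ∑ d, h' (Function.update D x d)) :
    ∑ D, h D ≤ ∑ D, h' D := by
  have := Finset.sum_le_sum fun D (_ : D ∈ Finset.univ) => H D
  rw [sum_sum_update, sum_sum_update] at this
  exact le_of_mul_le_mul_left this (by simp; positivity)

theorem sum_le_sum_of_update_update (x x' : X) {h h' : (X → Option Y) → ℝ}
    (H : ∀ D, ∑ d, ∑ d', h (Function.update (Function.update D x d) x' d') ≤
      ∑ d, ∑ d', h' (Function.update (Function.update D x d) x' d')) :
    ∑ D, h D ≤ ∑ D, h' D := by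
  have := sum_le_sum_of_update (h := fun D => ∑ d, h (Function.update D x' d))
    (h' := fun D => ∑ d, h' (Function.update D x' d)) x H
  rw [sum_sum_update, sum_sum_update] at this
  exact le_of_mul_le_mul_left this (by simp; positivity)

theorem sum_norm_sq_localOp_le (x : X) {m : Matrix (Option Y) (Option Y) ℂ}
    (hm : ∀ v : Option Y → ℂ, ∑ d, ‖(m *ᵥ v) d‖ ^ 2 ≤ ∑ d, ‖v d‖ ^ 2)
    {W : (X → Option Y) → ℝ} (hW : ∀ D, 0 ≤ W D) (hWx : ∀ D d, W (Function.update D x d) = W D)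
    (v : (X → Option Y) → ℂ) :
    ∑ D, W D * ‖localOp x m v D‖ ^ 2 ≤ ∑ D, W D * ‖v D‖ ^ 2 := by
  refine sum_le_sum_of_update x fun D => ?_
  simp only [localOp_update, hWx, ← Finset.mul_sum]
  exact mul_le_mul_of_nonneg_left (hm _) (hW D)

variable (Y) in
/-- The symmetric involution of `ℂ ^ (Option Y)` that exchanges the basis vector of `none` with
the uniform superposition of the other basis vectors, and fixes the vectors orthogonal to
both. -/
def exchange : Matrix (Option Y) (Option Y) ℂ
  | none, none => 0
  | none, some _ => (((√(Fintype.card Y))⁻¹ : ℝ) : ℂ)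
  | some _, none => (((√(Fintype.card Y))⁻¹ : ℝ) : ℂ)
  | some y, some z => (if y = z then 1 else 0) - (((Fintype.card Y : ℝ)⁻¹ : ℝ) : ℂ)

theorem inv_sqrt_card_mul_self : (((√(Fintype.card Y))⁻¹ : ℝ) : ℂ) * (((√(Fintype.card Y))⁻¹ : ℝ) : ℂ) =
    (((Fintype.card Y : ℝ)⁻¹ : ℝ) : ℂ) := by
  rw [← Complex.ofReal_mul, ← mul_inv, Real.mul_self_sqrt (Nat.cast_nonneg _)]

theorem exchange_mul_self [Nonempty Y] : exchange Y * exchange Y = 1 := by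
  have hn : (Fintype.card Y : ℂ) ≠ 0 := by simp
  have hs := inv_sqrt_card_mul_self (Y := Y)
  have hn' : (Fintype.card Y : ℂ) * (((Fintype.card Y : ℝ)⁻¹ : ℝ) : ℂ) = 1 := by
    push_cast; exact mul_inv_cancel₀ hn
  ext a b
  rw [Matrix.mul_apply, Fintype.sum_option]
  rcases a with _ | y <;> rcases b with _ | z
  · simp only [exchange, hs, Finset.sum_const, Finset.card_univ, nsmul_eq_mul, hn', mul_zero,
      zero_add, Matrix.one_apply_eq]
  · simp only [exchange, zero_mul, zero_add, ← Finset.mul_sum, Finset.sum_sub_distrib,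
      Finset.sum_ite_eq', Finset.mem_univ, if_true, Finset.sum_const, Finset.card_univ,
      nsmul_eq_mul, hn', sub_self, mul_zero]
    simp
  · simp only [exchange, mul_zero, zero_add, ← Finset.sum_mul, Finset.sum_sub_distrib,
      Finset.sum_ite_eq, Finset.mem_univ, if_true, Finset.sum_const, Finset.card_univ,
      nsmul_eq_mul, hn', sub_self, zero_mul]
    simp
  · simp only [exchange, hs, sub_mul, mul_sub, Finset.sum_sub_distrib, ite_mul, one_mul, zero_mul,
      mul_ite, mul_one, mul_zero, Finset.sum_ite_eq, Finset.sum_ite_eq', Finset.mem_univ, if_true,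
      Finset.sum_const, Finset.card_univ, nsmul_eq_mul, ← mul_assoc, hn']
    simp [Matrix.one_apply]

theorem exchange_conjTranspose : (exchange Y)ᴴ = exchange Y := by
  ext a b
  rw [Matrix.conjTranspose_apply]
  rcases a with _ | y <;> rcases b with _ | z <;> simp only [exchange]
  · simp
  · simp
  · simp
  · simp [eq_comm, apply_ite]

theorem sum_norm_sq_mulVec_of_conjTranspose_mul_self {n : Type*} [Fintype n] [DecidableEq n]
    {m : Matrix n n ℂ} (hm : mᴴ * m = 1) (v : n → ℂ) :
    ∑ d, ‖(m *ᵥ v) d‖ ^ 2 = ∑ d, ‖v d‖ ^ 2 := by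
  have h : ∀ w : n → ℂ, ((∑ d, ‖w d‖ ^ 2 : ℝ) : ℂ) = star w ⬝ᵥ w := fun w => by
    simp [dotProduct, Complex.conj_mul']
  have : ((∑ d, ‖(m *ᵥ v) d‖ ^ 2 : ℝ) : ℂ) = ((∑ d, ‖v d‖ ^ 2 : ℝ) : ℂ) := by
    rw [h, h, Matrix.star_mulVec, Matrix.dotProduct_mulVec, Matrix.vecMul_vecMul, hm,
      Matrix.vecMul_one]
  exact_mod_cast this

theorem sum_norm_sq_exchange_mulVec [Nonempty Y] (v : Option Y → ℂ) :
    ∑ d, ‖(exchange Y *ᵥ v) d‖ ^ 2 = ∑ d, ‖v d‖ ^ 2 :=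
  sum_norm_sq_mulVec_of_conjTranspose_mul_self
    (by rw [exchange_conjTranspose, exchange_mul_self]) v

variable (Y) in
/-- The change of basis to the recording basis on the registers listed in `l`. -/
def record (l : List X) : Module.End ℂ ((X → Option Y) → ℂ) :=
  (l.map fun x => localOp x (exchange Y)).prod

theorem record_cons (x : X) (l : List X) :
    record Y (x :: l) = localOp x (exchange Y) * record Y l := by simp [record]

theorem record_append (l l' : List X) : record Y (l ++ l') = record Y l * record Y l' := by
  simp [record]

theorem record_perm {l l' : List X} (h : l.Perm l') : record Y l = record Y l' := by
  refine (h.map _).prod_eq' ?_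
  rw [List.pairwise_map]
  refine List.pairwise_of_forall fun x x' => ?_
  rcases eq_or_ne x x' with rfl | hx
  exacts [Commute.refl _, localOp_commute hx _ _]

theorem record_commute_of_not_mem {x : X} {l : List X} (h : x ∉ l)
    (m : Matrix (Option Y) (Option Y) ℂ) : Commute (record Y l) (localOp x m) := by
  refine Commute.list_prod_left _ _ fun a ha => ?_
  obtain ⟨x', hx', rfl⟩ := List.mem_map.1 ha
  exact localOp_commute (ne_of_mem_of_not_mem hx' h) _ _

variable [Nonempty Y]

/-- The exchanges on other registers commute with `m`, so a query stays local in the recording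
basis. -/
theorem record_mul_localOp {x : X} {l : List X} (hl : l.Nodup) (h : x ∈ l)
    (m : Matrix (Option Y) (Option Y) ℂ) :
    record Y l * localOp x m = localOp x (exchange Y * m * exchange Y) * record Y l := by
  have hp := List.perm_cons_erase h
  have hx : x ∉ l.erase x := fun hx => (hl.mem_erase_iff.1 hx).1 rfl
  rw [record_perm hp, record_cons, mul_assoc, (record_commute_of_not_mem hx m).eq, ← mul_assoc,
    ← mul_assoc, localOp_mul, localOp_mul, mul_assoc (exchange Y * m), exchange_mul_self, mul_one]

theorem record_mul_self {l : List X} (hl : l.Nodup) : record Y l * record Y l = 1 := by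
  induction l with
  | nil => simp [record]
  | cons x l ih =>
    obtain ⟨hx, hl⟩ := List.nodup_cons.1 hl
    rw [record_cons, mul_assoc, ← mul_assoc (record Y l), (record_commute_of_not_mem hx _).eq,
      mul_assoc, ih hl, mul_one, localOp_mul, exchange_mul_self, localOp_one]

theorem sum_norm_sq_record_le (l : List X) {W : (X → Option Y) → ℝ} (hW : ∀ D, 0 ≤ W D)
    (hWl : ∀ x ∈ l, ∀ D d, W (Function.update D x d) = W D) (v : (X → Option Y) → ℂ) :
    ∑ D, W D * ‖record Y l v D‖ ^ 2 ≤ ∑ D, W D * ‖v D‖ ^ 2 := by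
  induction l with
  | nil => simp [record]
  | cons x l ih =>
    rw [record_cons]
    exact (sum_norm_sq_localOp_le x (fun v => (sum_norm_sq_exchange_mulVec v).le) hW
      (hWl x (by simp)) _).trans (ih fun x' hx' => hWl x' (by simp [hx']))

theorem localOp_prod (x : X) (m : Matrix (Option Y) (Option Y) ℂ) (h : X → Option Y → ℂ) :
    localOp x m (fun D => ∏ x', h x' (D x')) =
      fun D => ∏ x', Function.update h x (m *ᵥ h x) x' (D x') := by
  funext D
  have h1 : ∀ g : X → Option Y → ℂ, ∀ D : X → Option Y, ∏ x', g x' (D x') =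
      g x (D x) * ∏ x' ∈ Finset.univ.erase x, g x' (D x') := fun g D =>
    (Finset.mul_prod_erase _ _ (Finset.mem_univ x)).symm
  have h2 : ∀ d, ∏ x' ∈ Finset.univ.erase x, h x' (Function.update D x d x') =
      ∏ x' ∈ Finset.univ.erase x, h x' (D x') := fun d =>
    Finset.prod_congr rfl fun x' hx' => by rw [Function.update_of_ne (Finset.ne_of_mem_erase hx')]
  have h3 : ∏ x' ∈ Finset.univ.erase x, Function.update h x (m *ᵥ h x) x' (D x') =
      ∏ x' ∈ Finset.univ.erase x, h x' (D x') :=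
    Finset.prod_congr rfl fun x' hx' => by rw [Function.update_of_ne (Finset.ne_of_mem_erase hx')]
  simp only [localOp_apply]
  rw [h1, h3]
  simp only [h1 h, h2, Function.update_self, Matrix.mulVec, dotProduct, Finset.sum_mul, mul_assoc]

theorem record_prod {l : List X} (hl : l.Nodup) (h : Option Y → ℂ) :
    record Y l (fun D => ∏ x, h (D x)) =
      fun D => ∏ x, (if x ∈ l then exchange Y *ᵥ h else h) (D x) := by
  induction l with
  | nil => simp [record]
  | cons x l ih =>
    obtain ⟨hx, hl⟩ := List.nodup_cons.1 hl
    rw [record_cons, Module.End.mul_apply, ih hl,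
      localOp_prod x (exchange Y) fun x => if x ∈ l then exchange Y *ᵥ h else h]
    funext D
    refine Finset.prod_congr rfl fun x' _ => ?_
    rcases eq_or_ne x' x with rfl | hx'
    · simp [hx]
    · simp [hx']

variable (X Y) in
/-- The uniform superposition of all total functions. -/
def uniformState : (X → Option Y) → ℂ :=
  fun D => ∏ x, (if D x = none then 0 else (((√(Fintype.card Y))⁻¹ : ℝ) : ℂ))

theorem exchange_mulVec_uniform :
    (exchange Y *ᵥ fun d => if d = none then 0 else (((√(Fintype.card Y))⁻¹ : ℝ) : ℂ)) =
      fun d => if d = none then 1 else 0 := by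
  have hn : (Fintype.card Y : ℂ) ≠ 0 := by simp
  have hn' : (Fintype.card Y : ℂ) * (((Fintype.card Y : ℝ)⁻¹ : ℝ) : ℂ) = 1 := by
    push_cast; exact mul_inv_cancel₀ hn
  funext d
  simp only [Matrix.mulVec, dotProduct, Fintype.sum_option, if_true, mul_zero, zero_add,
    reduceCtorEq, if_false]
  rcases d with _ | y
  · simp only [exchange, inv_sqrt_card_mul_self, Finset.sum_const, Finset.card_univ, nsmul_eq_mul,
      hn', if_true]
  · simp only [exchange, ← Finset.sum_mul, Finset.sum_sub_distrib,
      Finset.sum_ite_eq, Finset.mem_univ, if_true, Finset.sum_const, Finset.card_univ,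
      nsmul_eq_mul, hn', sub_self, zero_mul]
    simp

theorem record_uniformState {l : List X} (hl : l.Nodup) (hmem : ∀ x, x ∈ l) :
    record Y l (uniformState X Y) = fun D => if ∀ x, D x = none then 1 else 0 := by
  have := record_prod hl fun d : Option Y =>
    if d = none then 0 else (((√(Fintype.card Y))⁻¹ : ℝ) : ℂ)
  simp only [hmem, if_true, exchange_mulVec_uniform] at this
  refine this.trans ?_
  funext D
  rw [Finset.prod_ite_zero]
  simp

end LocalOperators

/-! ### The effect of one query on the surplus. -/

noncomputable section QueryStep

variable {X Y : Type*} [Fintype X] [DecidableEq X] [Fintype Y] [DecidableEq Y]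

/-- The number of registers on which a database is defined. -/
def domSize (D : X → Option Y) : ℕ := (Finset.univ.filter fun x => D x ≠ none).card

/-- The set of values recorded in a database. -/
def values (D : X → Option Y) : Finset Y := Finset.univ.filter fun y => ∃ x, D x = some y

/-- The database has at least `k` more entries than distinct values. -/
def Surplus (k : ℕ) (D : X → Option Y) : Prop := k + (values D).card ≤ domSize D

theorem mem_values {D : X → Option Y} {y : Y} : y ∈ values D ↔ ∃ x, D x = some y := by
  simp [values]

theorem card_values_le (D : X → Option Y) : (values D).card ≤ domSize D := by
  classical
  have h : (values D).map ⟨some, Option.some_injective _⟩ ⊆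
      (Finset.univ.filter fun x => D x ≠ none).image D := by
    intro d hd
    obtain ⟨y, hy, rfl⟩ := Finset.mem_map.1 hd
    obtain ⟨x, hx⟩ := mem_values.1 hy
    exact Finset.mem_image.2 ⟨x, by simp [hx], hx⟩
  calc (values D).card = _ := (Finset.card_map _).symm
    _ ≤ _ := Finset.card_le_card h
    _ ≤ _ := Finset.card_image_le

theorem surplus_zero (D : X → Option Y) : Surplus 0 D := by
  simpa [Surplus] using card_values_le D

theorem values_update_some (D : X → Option Y) (x : X) (z : Y) :
    values (Function.update D x (some z)) = insert z (values (Function.update D x none)) := by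
  ext y
  rw [Finset.mem_insert, mem_values, mem_values]
  constructor
  · rintro ⟨x', hx'⟩
    rcases eq_or_ne x' x with rfl | h
    · left; simpa [eq_comm] using hx'
    · right; exact ⟨x', by rwa [Function.update_of_ne h] at hx' ⊢⟩
  · rintro (rfl | ⟨x', hx'⟩)
    · exact ⟨x, by simp⟩
    · rcases eq_or_ne x' x with rfl | h
      · simp at hx'
      · exact ⟨x', by rwa [Function.update_of_ne h] at hx' ⊢⟩

theorem domSize_update_some (D : X → Option Y) (x : X) (z : Y) :
    domSize (Function.update D x (some z)) = domSize (Function.update D x none) + 1 := by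
  have h : (Finset.univ.filter fun x' => Function.update D x (some z) x' ≠ none) =
      insert x (Finset.univ.filter fun x' => Function.update D x none x' ≠ none) := by
    ext x'
    rcases eq_or_ne x' x with rfl | h <;> simp [*]
  rw [domSize, h, Finset.card_insert_of_notMem (by simp), domSize]

theorem domSize_update_none_le (D : X → Option Y) (x : X) (d : Option Y) :
    domSize (Function.update D x none) ≤ domSize (Function.update D x d) := by
  cases d with
  | none => rfl
  | some z => rw [domSize_update_some]; omega

theorem domSize_le_domSize_update_add_one (D : X → Option Y) (x : X) (d : Option Y) :
    domSize D ≤ domSize (Function.update D x d) + 1 := by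
  have h1 := domSize_update_none_le D x d
  have h2 : domSize D ≤ domSize (Function.update D x none) + 1 := by
    conv_lhs => rw [← Function.update_eq_self x D]
    cases D x with
    | none => omega
    | some z => rw [domSize_update_some]
  omega

theorem norm_add_four_sq_le (a b c d : ℂ) :
    ‖a + b + c + d‖ ^ 2 ≤ 4 * (‖a‖ ^ 2 + ‖b‖ ^ 2 + ‖c‖ ^ 2 + ‖d‖ ^ 2) := by
  have h : ‖a + b + c + d‖ ≤ ‖a‖ + ‖b‖ + ‖c‖ + ‖d‖ :=
    (norm_add_le _ _).trans (by gcongr; exact norm_add₃_le)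
  have h2 := pow_le_pow_left₀ (norm_nonneg _) h 2
  nlinarith [sq_nonneg (‖a‖ - ‖b‖), sq_nonneg (‖a‖ - ‖c‖), sq_nonneg (‖a‖ - ‖d‖),
    sq_nonneg (‖b‖ - ‖c‖), sq_nonneg (‖b‖ - ‖d‖), sq_nonneg (‖c‖ - ‖d‖)]

/-- The hypothesis is on the products, so `r i` is free where `a i = 0`. This is how the diagonal
entries of `phaseMatrix`, which need not be small, are avoided. -/
theorem norm_sum_mul_sq_le {ι : Type*} [Fintype ι] (r a : ι → ℂ) (c : ι → ℝ)
    (h : ∀ i, ‖r i * a i‖ ≤ c i * ‖a i‖) :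
    ‖∑ i, r i * a i‖ ^ 2 ≤ (∑ i, c i ^ 2) * ∑ i, ‖a i‖ ^ 2 := by
  have h1 : ‖∑ i, r i * a i‖ ≤ ∑ i, c i * ‖a i‖ :=
    (norm_sum_le _ _).trans (Finset.sum_le_sum fun i _ => h i)
  exact (pow_le_pow_left₀ (norm_nonneg _) h1 2).trans (Finset.sum_mul_sq_le_sq_mul_sq _ _ _)

/-- The matrix, in the recording basis, of the phase `u` on one register. -/
def phaseMatrix (u : Y → ℂ) : Matrix (Option Y) (Option Y) ℂ :=
  -- The value `0` at `none` is harmless, since total functions never take it. The result is a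
  -- contraction, which is all that is needed.
  exchange Y * Matrix.diagonal (fun d => d.elim 0 u) * exchange Y

theorem sum_norm_sq_phaseMatrix_mulVec_le [Nonempty Y] {u : Y → ℂ} (hu : ∀ y, ‖u y‖ ≤ 1)
    (v : Option Y → ℂ) : ∑ d, ‖(phaseMatrix u *ᵥ v) d‖ ^ 2 ≤ ∑ d, ‖v d‖ ^ 2 := by
  rw [phaseMatrix, ← Matrix.mulVec_mulVec, ← Matrix.mulVec_mulVec, sum_norm_sq_exchange_mulVec,
    ← sum_norm_sq_exchange_mulVec v]
  refine Finset.sum_le_sum fun d _ => ?_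
  rw [Matrix.mulVec_diagonal, norm_mul]
  refine pow_le_pow_left₀ (by positivity) (mul_le_of_le_one_left (norm_nonneg _) ?_) 2
  cases d <;> simp [hu]

theorem phaseMatrix_apply (u : Y → ℂ) (c d : Option Y) :
    phaseMatrix u c d = ∑ y, exchange Y c (some y) * u y * exchange Y (some y) d := by
  rw [phaseMatrix, Matrix.mul_apply, Fintype.sum_option]
  simp [Matrix.mul_diagonal]

theorem norm_inv_card_mul_sum_le [Nonempty Y] {u : Y → ℂ} (hu : ∀ y, ‖u y‖ ≤ 1) :
    ‖(((Fintype.card Y : ℝ)⁻¹ : ℝ) : ℂ) * ∑ y, u y‖ ≤ 1 := by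
  have hn : (0 : ℝ) < Fintype.card Y := by exact_mod_cast Fintype.card_pos
  have : ‖∑ y, u y‖ ≤ Fintype.card Y :=
    (norm_sum_le _ _).trans ((Finset.sum_le_sum fun y _ => hu y).trans_eq (by simp))
  rw [norm_mul, Complex.norm_real, Real.norm_of_nonneg (by positivity), inv_mul_le_iff₀ hn]
  linarith

theorem norm_phaseMatrix_some_none_le [Nonempty Y] {u : Y → ℂ} (hu : ∀ y, ‖u y‖ ≤ 1) (z : Y) :
    ‖phaseMatrix u (some z) none‖ ≤ 2 * (√(Fintype.card Y))⁻¹ := by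
  have : phaseMatrix u (some z) none =
      (u z - (((Fintype.card Y : ℝ)⁻¹ : ℝ) : ℂ) * ∑ y, u y) * (((√(Fintype.card Y))⁻¹ : ℝ) : ℂ) := by
    simp only [phaseMatrix_apply, exchange, ← Finset.sum_mul, sub_mul, ite_mul, one_mul, zero_mul,
      Finset.sum_sub_distrib, Finset.sum_ite_eq, Finset.mem_univ, if_true, Finset.mul_sum]
  rw [this, norm_mul, Complex.norm_real, Real.norm_of_nonneg (by positivity)]
  gcongr
  exact (norm_sub_le _ _).trans (by linarith [hu z, norm_inv_card_mul_sum_le hu])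

theorem norm_phaseMatrix_some_some_le [Nonempty Y] {u : Y → ℂ} (hu : ∀ y, ‖u y‖ ≤ 1) {z w : Y}
    (h : w ≠ z) : ‖phaseMatrix u (some z) (some w)‖ ≤ 3 * (Fintype.card Y : ℝ)⁻¹ := by
  have : phaseMatrix u (some z) (some w) = ((((Fintype.card Y : ℝ)⁻¹ : ℝ) : ℂ) * ∑ y, u y - u z - u w)
      * (((Fintype.card Y : ℝ)⁻¹ : ℝ) : ℂ) := by
    simp only [phaseMatrix_apply, exchange, sub_mul, mul_sub, ite_mul, one_mul, zero_mul,
      mul_ite, mul_one, mul_zero, Finset.sum_sub_distrib, Finset.sum_ite_eq, Finset.sum_ite_eq',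
      Finset.mem_univ, if_true, h.symm, if_false, ← Finset.sum_mul, ← Finset.mul_sum]
    ring
  rw [this, norm_mul, Complex.norm_real, Real.norm_of_nonneg (by positivity)]
  gcongr
  refine (norm_sub_le _ _).trans ?_
  linarith [norm_sub_le ((((Fintype.card Y : ℝ)⁻¹ : ℝ) : ℂ) * ∑ y, u y) (u z), hu z, hu w,
    norm_inv_card_mul_sum_le hu]

/-- Off the diagonal, a row has one entry of size at most `2 / √n` and the others at most `3 / n`,
with `n = Fintype.card Y`; hence `4 / n + 9 / n = 13 / n`. -/
theorem sum_norm_sq_phaseMatrix_mulVec_le_of_eq_zero [Nonempty Y] {u : Y → ℂ}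
    (hu : ∀ y, ‖u y‖ ≤ 1) (I : Finset Y) (a : Option Y → ℂ) (ha : ∀ z ∈ I, a (some z) = 0) :
    ∑ z ∈ I, ‖(phaseMatrix u *ᵥ a) (some z)‖ ^ 2 ≤
      I.card * (13 / Fintype.card Y * ∑ d, ‖a d‖ ^ 2) := by
  have hn : (0 : ℝ) < Fintype.card Y := by exact_mod_cast Fintype.card_pos
  rw [← nsmul_eq_mul]
  refine Finset.sum_le_card_nsmul _ _ _ fun z hz => ?_
  have := norm_sum_mul_sq_le (fun d => phaseMatrix u (some z) d) a
    (fun d => d.elim (2 * (√(Fintype.card Y))⁻¹) fun _ => 3 * (Fintype.card Y : ℝ)⁻¹) ?_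
  · refine this.trans_eq ?_
    congr 1
    rw [Fintype.sum_option]
    simp only [Option.elim_none, Option.elim_some, Finset.sum_const, Finset.card_univ,
      nsmul_eq_mul, mul_pow, inv_pow, Real.sq_sqrt hn.le]
    field_simp
    norm_num
  · rintro (_ | w)
    · rw [norm_mul]
      exact mul_le_mul_of_nonneg_right (norm_phaseMatrix_some_none_le hu z) (norm_nonneg _)
    · rcases eq_or_ne w z with rfl | h
      · simp [ha w hz]
      · rw [norm_mul]
        exact mul_le_mul_of_nonneg_right (norm_phaseMatrix_some_some_le hu h) (norm_nonneg _)

open Classical in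
/-- A query moves little weight to databases with a larger surplus. -/
theorem sum_surplus_norm_sq_localOp_le [Nonempty Y] {u : Y → ℂ} (hu : ∀ y, ‖u y‖ ≤ 1) (x : X)
    (k t : ℕ) (v : (X → Option Y) → ℂ) (hv : ∀ D, v D ≠ 0 → domSize D ≤ t) :
    ∑ D, (if Surplus (k + 1) D then
      ‖localOp x (phaseMatrix u) (fun D => if Surplus (k + 1) D then 0 else v D) D‖ ^ 2 else 0) ≤
    13 * t / Fintype.card Y * ∑ D, if Surplus k D then ‖v D‖ ^ 2 else 0 := by
  have hn : (0 : ℝ) < Fintype.card Y := by exact_mod_cast Fintype.card_pos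
  rw [Finset.mul_sum]
  refine sum_le_sum_of_update x fun D => ?_
  -- The surplus with `x` erased decides everything: writing `z` at `x` raises it by one exactly
  -- when `z ∈ I`.
  set I := values (Function.update D x none) with hI
  set m := domSize (Function.update D x none) with hm
  have hIm : I.card ≤ m := card_values_le _
  have hnone : ∀ j, Surplus j (Function.update D x none) ↔ j + I.card ≤ m := fun j => Iff.rfl
  have hin : ∀ j, ∀ z ∈ I, Surplus j (Function.update D x (some z)) ↔ j + I.card ≤ m + 1 := by
    intro j z hz
    rw [Surplus, domSize_update_some, values_update_some, ← hI, Finset.insert_eq_of_mem hz]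
  have hout : ∀ j, ∀ z ∉ I, Surplus j (Function.update D x (some z)) ↔ j + I.card ≤ m := by
    intro j z hz
    rw [Surplus, domSize_update_some, values_update_some, ← hI, Finset.card_insert_of_notMem hz]
    omega
  simp only [localOp_update]
  set a : Option Y → ℂ := fun d => if Surplus (k + 1) (Function.update D x d) then 0 else
    v (Function.update D x d) with ha
  have hR : 0 ≤ ∑ d, 13 * (t : ℝ) / Fintype.card Y *
      (if Surplus k (Function.update D x d) then ‖v (Function.update D x d)‖ ^ 2 else 0) :=
    Finset.sum_nonneg fun d _ => mul_nonneg (by positivity) (by split_ifs <;> positivity)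
  rcases lt_trichotomy (k + I.card) m with h | h | h
  -- The surplus exceeds `k` whatever is stored at `x`, so nothing is left of the truncated vector.
  · have h0 : a = 0 := by
      funext d
      have : Surplus (k + 1) (Function.update D x d) := by
        rcases d with _ | z
        · rw [hnone]; omega
        · by_cases hz : z ∈ I
          · rw [hin _ z hz]; omega
          · rw [hout _ z hz]; omega
      simp [ha, this]
    simpa [h0] using hR
  -- The only case that contributes: surplus `k + 1` is reached exactly by the values in `I`, and
  -- `I` has at most `t` elements if `v` is nonzero somewhere on the fibre.
  · have hk : ∀ d, Surplus k (Function.update D x d) := by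
      rintro (_ | z)
      · rw [hnone]; omega
      · by_cases hz : z ∈ I
        · rw [hin _ z hz]; omega
        · rw [hout _ z hz]; omega
    have hk1 : ∀ z, Surplus (k + 1) (Function.update D x (some z)) ↔ z ∈ I := fun z => by
      by_cases hz : z ∈ I
      · simp only [hin _ z hz, hz, iff_true]; omega
      · simp only [hout _ z hz, hz, iff_false]; omega
    have hk0 : ¬ Surplus (k + 1) (Function.update D x none) := by rw [hnone]; omega
    rw [Fintype.sum_option]
    simp only [hk0, if_false, zero_add, hk1, hk, if_true]
    rw [← Finset.sum_filter, Finset.filter_univ_mem]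
    refine (sum_norm_sq_phaseMatrix_mulVec_le_of_eq_zero hu I a fun z hz => ?_).trans ?_
    · simp [ha, hk1, hz]
    · rw [Finset.mul_sum, Finset.mul_sum]
      refine Finset.sum_le_sum fun d _ => ?_
      by_cases h0 : v (Function.update D x d) = 0
      · simp [ha, h0]
      · have hIt : (I.card : ℝ) ≤ t := by
          exact_mod_cast (hIm.trans (domSize_update_none_le D x d)).trans (hv _ h0)
        have hle : ‖a d‖ ^ 2 ≤ ‖v (Function.update D x d)‖ ^ 2 := by
          simp only [ha]
          split_ifs <;> simp
        calc (I.card : ℝ) * (13 / Fintype.card Y * ‖a d‖ ^ 2)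
            ≤ t * (13 / Fintype.card Y * ‖v (Function.update D x d)‖ ^ 2) := by gcongr
          _ = _ := by ring
  -- Even a repeated value does not reach surplus `k + 1`.
  · have h0 : ∀ d, ¬ Surplus (k + 1) (Function.update D x d) := by
      rintro (_ | z)
      · rw [hnone]; omega
      · by_cases hz : z ∈ I
        · rw [hin _ z hz]; omega
        · rw [hout _ z hz]; omega
    simpa [h0] using hR

theorem domSize_le_of_localOp_ne_zero (x : X) (m : Matrix (Option Y) (Option Y) ℂ) {t : ℕ}
    {v : (X → Option Y) → ℂ} (hv : ∀ D, v D ≠ 0 → domSize D ≤ t) (D : X → Option Y)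
    (h : localOp x m v D ≠ 0) : domSize D ≤ t + 1 := by
  rw [localOp_apply] at h
  obtain ⟨d, -, hd⟩ := Finset.exists_ne_zero_of_sum_ne_zero h
  exact (domSize_le_domSize_update_add_one D x d).trans
    (Nat.add_le_add_right (hv _ (right_ne_zero_of_mul hd)) 1)

end QueryStep

/-! ### Growth of the surplus over many queries. -/

noncomputable section Progress

variable {X Y : Type*} [Fintype X] [DecidableEq X] [Fintype Y] [DecidableEq Y]

theorem sum_norm_add_sq_le {ι : Type*} [Fintype ι] (a b : ι → ℂ) {p q : ℝ} (hp : 0 ≤ p)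
    (hq : 0 ≤ q) (ha : ∑ i, ‖a i‖ ^ 2 ≤ p ^ 2) (hb : ∑ i, ‖b i‖ ^ 2 ≤ q ^ 2) :
    ∑ i, ‖a i + b i‖ ^ 2 ≤ (p + q) ^ 2 := by
  have h1 : ∑ i, ‖a i‖ * ‖b i‖ ≤ p * q := by
    refine abs_le_of_sq_le_sq' ?_ (by positivity) |>.2
    rw [mul_pow]
    exact (Finset.sum_mul_sq_le_sq_mul_sq _ _ _).trans
      (mul_le_mul ha hb (by positivity) (by positivity))
  have h2 : ∑ i, ‖a i + b i‖ ^ 2 ≤ ∑ i, (‖a i‖ ^ 2 + 2 * (‖a i‖ * ‖b i‖) + ‖b i‖ ^ 2) :=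
    Finset.sum_le_sum fun i _ => (pow_le_pow_left₀ (norm_nonneg _) (norm_add_le _ _) 2).trans_eq
      (by ring)
  rw [Finset.sum_add_distrib, Finset.sum_add_distrib, ← Finset.mul_sum] at h2
  nlinarith

open Classical in
/-- The family `Φ` of vectors in the recording basis is what at most `t` queries can produce, when
each query adds at most `ε` times the amplitude of surplus `k` to that of surplus `k + 1`. -/
def ProgressBound {J : Type*} [Fintype J] (t : ℕ) (ε α : ℝ) (Φ : J → (X → Option Y) → ℂ) : Prop :=
  (∀ j D, Φ j D ≠ 0 → domSize D ≤ t) ∧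
    ∀ k, ∑ j, ∑ D, (if Surplus k D then ‖Φ j D‖ ^ 2 else 0) ≤ (t.choose k * ε ^ k * α) ^ 2

open Classical in
-- The vector is split according to surplus `k + 1`. On the part that has it, the query is a
-- contraction; from the other part, only a small weight gains it.
theorem exists_add_of_query [Nonempty Y] (k t : ℕ) (v v' : (X → Option Y) → ℂ)
    (hv : ∀ D, v D ≠ 0 → domSize D ≤ t)
    (h : v' = v ∨ ∃ (x : X) (u : Y → ℂ), (∀ y, ‖u y‖ ≤ 1) ∧ v' = localOp x (phaseMatrix u) v) :
    ∃ a b : (X → Option Y) → ℂ, v' = a + b ∧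
      ∑ D, ‖a D‖ ^ 2 ≤ ∑ D, (if Surplus (k + 1) D then ‖v D‖ ^ 2 else 0) ∧
      ∑ D, (if Surplus (k + 1) D then ‖b D‖ ^ 2 else 0) ≤
        13 * t / Fintype.card Y * ∑ D, (if Surplus k D then ‖v D‖ ^ 2 else 0) := by
  have hsplit : v = (fun D => if Surplus (k + 1) D then v D else 0) +
      (fun D => if Surplus (k + 1) D then 0 else v D) := by
    funext D
    simp only [Pi.add_apply]
    split_ifs <;> simp
  have ha : ∑ D, ‖(if Surplus (k + 1) D then v D else 0)‖ ^ 2 =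
      ∑ D, (if Surplus (k + 1) D then ‖v D‖ ^ 2 else 0) :=
    Finset.sum_congr rfl fun D _ => by split_ifs <;> simp
  rcases h with rfl | ⟨x, u, hu, rfl⟩
  · refine ⟨_, _, hsplit, ha.le, ?_⟩
    refine le_trans (le_of_eq ?_) (mul_nonneg (by positivity)
      (Finset.sum_nonneg fun D _ => by split_ifs <;> positivity))
    exact Finset.sum_eq_zero fun D _ => by split_ifs <;> simp
  · refine ⟨_, _, (congrArg (localOp x (phaseMatrix u)) hsplit).trans (map_add _ _ _), ?_,
      sum_surplus_norm_sq_localOp_le hu x k t v hv⟩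
    rw [← ha]
    have := sum_norm_sq_localOp_le x (sum_norm_sq_phaseMatrix_mulVec_le hu)
      (W := fun _ => 1) (fun _ => zero_le_one) (fun _ _ => rfl)
      (fun D => if Surplus (k + 1) D then v D else 0)
    simpa only [one_mul] using this

open Classical in
-- By Minkowski, the amplitude of surplus `k + 1` grows by at most `ε` times that of surplus `k`.
-- The binomial coefficients solve this recursion, by Pascal's rule.
theorem ProgressBound.query [Nonempty Y] {J : Type*} [Fintype J] {t : ℕ} {ε α : ℝ}
    {Φ Φ' : J → (X → Option Y) → ℂ} (hα : 0 ≤ α) (hε : 0 ≤ ε)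
    (ht : 13 * t / Fintype.card Y ≤ ε ^ 2) (hΦ : ProgressBound t ε α Φ)
    (h : ∀ j, Φ' j = Φ j ∨ ∃ (x : X) (u : Y → ℂ), (∀ y, ‖u y‖ ≤ 1) ∧
      Φ' j = localOp x (phaseMatrix u) (Φ j)) :
    ProgressBound (t + 1) ε α Φ' := by
  obtain ⟨hdom, hk⟩ := hΦ
  refine ⟨fun j D hD => ?_, fun k => ?_⟩
  · rcases h j with h | ⟨x, u, -, h⟩
    · rw [h] at hD
      exact (hdom j D hD).trans (Nat.le_succ t)
    · rw [h] at hD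
      exact domSize_le_of_localOp_ne_zero x _ (hdom j) D hD
  cases k with
  | zero =>
    have h0 := hk 0
    simp only [surplus_zero, if_true, Nat.choose_zero_right, pow_zero] at h0 ⊢
    refine (Finset.sum_le_sum fun j _ => ?_).trans h0
    rcases h j with h | ⟨x, u, hu, h⟩
    · rw [h]
    · rw [h]
      have := sum_norm_sq_localOp_le x (sum_norm_sq_phaseMatrix_mulVec_le hu)
        (W := fun _ => 1) (fun _ => zero_le_one) (fun _ _ => rfl) (Φ j)
      simpa only [one_mul] using this
  | succ k =>
    choose a b hab ha hb using fun j => exists_add_of_query k t (Φ j) (Φ' j) (hdom j) (h j)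
    have hA : ∑ p : J × (X → Option Y), ‖(if Surplus (k + 1) p.2 then a p.1 p.2 else 0)‖ ^ 2 ≤
        (t.choose (k + 1) * ε ^ (k + 1) * α) ^ 2 := by
      rw [Fintype.sum_prod_type]
      refine (Finset.sum_le_sum fun j _ => (Finset.sum_le_sum fun D _ => ?_).trans (ha j)).trans
        (hk (k + 1))
      split_ifs <;> simp
    have hB : ∑ p : J × (X → Option Y), ‖(if Surplus (k + 1) p.2 then b p.1 p.2 else 0)‖ ^ 2 ≤
        (ε * (t.choose k * ε ^ k * α)) ^ 2 := by
      rw [Fintype.sum_prod_type, mul_pow]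
      calc _ ≤ ∑ j, 13 * t / Fintype.card Y * ∑ D, (if Surplus k D then ‖Φ j D‖ ^ 2 else 0) := by
            refine Finset.sum_le_sum fun j _ => le_trans (le_of_eq ?_) (hb j)
            exact Finset.sum_congr rfl fun D _ => by split_ifs <;> simp
        _ ≤ _ := by
            rw [← Finset.mul_sum]
            exact mul_le_mul ht (hk k) (Finset.sum_nonneg fun j _ => Finset.sum_nonneg fun D _ => by
              split_ifs <;> positivity) (by positivity)
    have := sum_norm_add_sq_le _ _ (by positivity) (by positivity) hA hB
    rw [Fintype.sum_prod_type] at this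
    refine le_trans (le_of_eq ?_) (this.trans_eq ?_)
    · refine Finset.sum_congr rfl fun j _ => Finset.sum_congr rfl fun D _ => ?_
      rw [hab j]
      split_ifs <;> simp
    · rw [Nat.choose_succ_succ]
      push_cast
      ring

end Progress

/-! ### From collisions of `f` to recorded pairs. -/

noncomputable section Collisions

variable {X Y : Type*} [Fintype X] [DecidableEq X] [Fintype Y] [DecidableEq Y]

/-- The part of the rows of `exchange Y` that does not depend on the row. -/
def exchangeTail (d : Option Y) : ℂ :=
  d.elim (((√(Fintype.card Y))⁻¹ : ℝ) : ℂ) fun _ => -(((Fintype.card Y : ℝ)⁻¹ : ℝ) : ℂ)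

theorem exchange_some_apply (y : Y) (d : Option Y) :
    exchange Y (some y) d = (if d = some y then 1 else 0) + exchangeTail d := by
  rcases d with _ | z
  · simp [exchange, exchangeTail]
  · simp [exchange, exchangeTail, eq_comm, sub_eq_add_neg]

theorem sum_exchange_some_mul (y : Y) (a : Option Y → ℂ) :
    ∑ d, exchange Y (some y) d * a d = a (some y) + ∑ d, exchangeTail d * a d := by
  simp only [exchange_some_apply, add_mul, Finset.sum_add_distrib, ite_mul, one_mul, zero_mul,
    Finset.sum_ite_eq', Finset.mem_univ, if_true]

theorem norm_sum_exchangeTail_mul_sq_le [Nonempty Y] (a : Option Y → ℂ) :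
    ‖∑ d, exchangeTail d * a d‖ ^ 2 ≤ 2 / Fintype.card Y * ∑ d, ‖a d‖ ^ 2 := by
  have hn : (0 : ℝ) < Fintype.card Y := by exact_mod_cast Fintype.card_pos
  refine (norm_sum_mul_sq_le exchangeTail a (fun d => ‖exchangeTail (Y := Y) d‖)
    fun d => (norm_mul _ _).le).trans_eq ?_
  congr 1
  rw [Fintype.sum_option]
  simp only [exchangeTail, Option.elim_none, Option.elim_some, norm_neg, Complex.norm_real,
    Real.norm_of_nonneg (inv_nonneg.2 (Real.sqrt_nonneg _)),
    Real.norm_of_nonneg (inv_nonneg.2 hn.le), inv_pow, Real.sq_sqrt hn.le,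
    Finset.sum_const, Finset.card_univ, nsmul_eq_mul]
  field_simp
  norm_num

/-- A row `some y` of `exchange Y` is a basis vector plus a tail of squared norm `2 / n` common to
all `y`. Two rows give four terms; those with a tail contribute `4 * (2 / n + 2 / n + n * (2 / n) ^
2) = 32 / n`. -/
theorem sum_norm_sq_exchange_exchange_le [Nonempty Y] (v : Option Y → Option Y → ℂ) :
    ∑ y, ‖∑ d, exchange Y (some y) d * ∑ d', exchange Y (some y) d' * v d d'‖ ^ 2 ≤
      4 * ∑ y, ‖v (some y) (some y)‖ ^ 2 + 32 / Fintype.card Y * ∑ d, ∑ d', ‖v d d'‖ ^ 2 := by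
  have hn : (0 : ℝ) < Fintype.card Y := by exact_mod_cast Fintype.card_pos
  set n : ℝ := (Fintype.card Y : ℝ) with hn_def
  set V : ℝ := ∑ d, ∑ d', ‖v d d'‖ ^ 2 with hV
  have hV' : V = ∑ d', ∑ d, ‖v d d'‖ ^ 2 := Finset.sum_comm
  have h1 : ∀ y, ‖∑ d, exchange Y (some y) d * ∑ d', exchange Y (some y) d' * v d d'‖ ^ 2 ≤
      4 * (‖v (some y) (some y)‖ ^ 2 + 2 / n * ∑ d', ‖v (some y) d'‖ ^ 2 +
        2 / n * ∑ d, ‖v d (some y)‖ ^ 2 + 2 / n * (2 / n * V)) := by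
    intro y
    have hy : ∑ d, exchange Y (some y) d * ∑ d', exchange Y (some y) d' * v d d' =
        v (some y) (some y) + ∑ d', exchangeTail d' * v (some y) d' +
          ∑ d, exchangeTail d * v d (some y) +
          ∑ d, exchangeTail d * ∑ d', exchangeTail d' * v d d' := by
      simp only [sum_exchange_some_mul, mul_add, Finset.sum_add_distrib]
      ring
    rw [hy]
    refine (norm_add_four_sq_le _ _ _ _).trans ?_
    gcongr
    · exact norm_sum_exchangeTail_mul_sq_le _
    · exact norm_sum_exchangeTail_mul_sq_le _
    · refine (norm_sum_exchangeTail_mul_sq_le _).trans ?_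
      have hd : ∑ d : Option Y, ‖∑ d', exchangeTail d' * v d d'‖ ^ 2 ≤ 2 / n * V :=
        (Finset.sum_le_sum fun d _ => norm_sum_exchangeTail_mul_sq_le (v d)).trans_eq
          (Finset.mul_sum _ _ _).symm
      exact mul_le_mul_of_nonneg_left hd (by positivity)
  refine (Finset.sum_le_sum fun y _ => h1 y).trans ?_
  have h2 : ∑ y, ∑ d', ‖v (some y) d'‖ ^ 2 ≤ V := by
    rw [hV, Fintype.sum_option]
    exact le_add_of_nonneg_left (by positivity)
  have h3 : ∑ y, ∑ d, ‖v d (some y)‖ ^ 2 ≤ V := by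
    rw [hV', Fintype.sum_option]
    exact le_add_of_nonneg_left (by positivity)
  simp only [← Finset.mul_sum, Finset.sum_add_distrib, Finset.sum_const, Finset.card_univ,
    nsmul_eq_mul, ← hn_def]
  have h4 : 2 / n * (2 / n * (n * V)) = 4 / n * V := by field_simp; ring
  have h5 : 2 / n * ∑ y, ∑ d', ‖v (some y) d'‖ ^ 2 ≤ 2 / n * V := by gcongr
  have h6 : 2 / n * ∑ y, ∑ d, ‖v d (some y)‖ ^ 2 ≤ 2 / n * V := by gcongr
  have h7 : 32 / n * V = 4 * (2 / n * V + 2 / n * V + 4 / n * V) := by ring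
  rw [h4, h7]
  linarith

/-- The database records a collision at the pair `z`. -/
def Records (z : X × X) (D : X → Option Y) : Prop := D z.1 = D z.2 ∧ D z.1 ≠ none

instance (z : X × X) (D : X → Option Y) : Decidable (Records z D) :=
  inferInstanceAs (Decidable (_ ∧ _))

/-- An upper bound on the chance to see a collision at `z` when the database is `D`. -/
def recordWeight (z : X × X) (D : X → Option Y) : ℝ :=
  if Records z D then 8 else 32 / Fintype.card Y

theorem recordWeight_nonneg (z : X × X) (D : X → Option Y) : 0 ≤ recordWeight z D := by
  unfold recordWeight
  split_ifs <;> positivity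

theorem records_update_iff {z : X × X} {x : X} (h1 : x ≠ z.1) (h2 : x ≠ z.2) (D : X → Option Y)
    (d : Option Y) : Records z (Function.update D x d) ↔ Records z D := by
  rw [Records, Function.update_of_ne h1.symm, Function.update_of_ne h2.symm, Records]

theorem recordWeight_update {z : X × X} {x : X} (h1 : x ≠ z.1) (h2 : x ≠ z.2) (D : X → Option Y)
    (d : Option Y) : recordWeight z (Function.update D x d) = recordWeight z D := by
  simp only [recordWeight, records_update_iff h1 h2]

/-- A recorded pair enters both terms of `sum_norm_sq_exchange_exchange_le`, and `4 + 32 / n ≤ 8`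
when `n ≥ 8`. The weight `W` makes room for the other pairs. -/
theorem sum_records_norm_sq_le [Nonempty Y] (hY : 8 ≤ Fintype.card Y) {z : X × X}
    (hz : z.1 ≠ z.2) {W : (X → Option Y) → ℝ} (hW : ∀ D, 0 ≤ W D)
    (hW1 : ∀ D d, W (Function.update D z.1 d) = W D)
    (hW2 : ∀ D d, W (Function.update D z.2 d) = W D) (v : (X → Option Y) → ℂ) :
    ∑ D, (if Records z D then
      W D * ‖localOp z.1 (exchange Y) (localOp z.2 (exchange Y) v) D‖ ^ 2 else 0) ≤
      ∑ D, W D * recordWeight z D * ‖v D‖ ^ 2 := by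
  have hn : (8 : ℝ) ≤ Fintype.card Y := by exact_mod_cast hY
  refine sum_le_sum_of_update_update z.1 z.2 fun D => ?_
  set w : Option Y → Option Y → ℂ := fun d d' =>
    v (Function.update (Function.update D z.1 d) z.2 d') with hw
  have happly : ∀ d d', localOp z.1 (exchange Y) (localOp z.2 (exchange Y) v)
      (Function.update (Function.update D z.1 d) z.2 d') =
      ∑ e, exchange Y d e * ∑ e', exchange Y d' e' * w e e' := by
    intro d d'
    simp only [localOp_apply, hw]
    rw [Function.update_of_ne hz, Function.update_self]
    refine Finset.sum_congr rfl fun e _ => ?_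
    rw [Function.update_of_ne hz.symm, Function.update_self]
    congr 1
    refine Finset.sum_congr rfl fun e' _ => ?_
    rw [Function.update_comm hz.symm, Function.update_idem, Function.update_idem]
  have hrec : ∀ d d', Records z (Function.update (Function.update D z.1 d) z.2 d') ↔
      d = d' ∧ d ≠ none := by
    intro d d'
    rw [Records, Function.update_of_ne hz, Function.update_self, Function.update_self]
  simp only [happly, hW1, hW2, recordWeight, hrec]
  have hl : ∑ d : Option Y, ∑ d' : Option Y, (if d = d' ∧ d ≠ none then W D *
      ‖∑ e, exchange Y d e * ∑ e', exchange Y d' e' * w e e'‖ ^ 2 else 0) =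
      W D * ∑ y, ‖∑ e, exchange Y (some y) e * ∑ e', exchange Y (some y) e' * w e e'‖ ^ 2 := by
    rw [Finset.mul_sum, Fintype.sum_option]
    simp
  have hr : ∑ d : Option Y, ∑ d' : Option Y, W D * (if d = d' ∧ d ≠ none then 8 else
      32 / (Fintype.card Y : ℝ)) * ‖w d d'‖ ^ 2 =
      W D * ((8 - 32 / (Fintype.card Y : ℝ)) * ∑ y, ‖w (some y) (some y)‖ ^ 2 +
        32 / (Fintype.card Y : ℝ) * ∑ d, ∑ d', ‖w d d'‖ ^ 2) := by
    have : ∀ d d', W D * (if d = d' ∧ d ≠ none then 8 else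
      32 / (Fintype.card Y : ℝ)) * ‖w d d'‖ ^ 2 = W D * ((8 - 32 / (Fintype.card Y : ℝ)) *
        (if d = d' ∧ d ≠ none then ‖w d d'‖ ^ 2 else 0)) +
        W D * (32 / (Fintype.card Y : ℝ) * ‖w d d'‖ ^ 2) := by
      intro d d'
      split_ifs <;> ring
    simp only [this, Finset.sum_add_distrib, ← Finset.mul_sum, ← mul_add]
    congr 3
    rw [Fintype.sum_option]
    simp
  rw [hl, show (∑ d : Option Y, ∑ d' : Option Y, W D * (if d = d' ∧ d ≠ none then 8 else
      32 / (Fintype.card Y : ℝ)) * ‖v (Function.update (Function.update D z.1 d) z.2 d')‖ ^ 2) = _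
      from hr]
  refine mul_le_mul_of_nonneg_left ((sum_norm_sq_exchange_exchange_le w).trans ?_) (hW D)
  gcongr
  have : 32 / (Fintype.card Y : ℝ) ≤ 4 := by
    rw [div_le_iff₀ (by linarith)]; linarith
  linarith

/-- No register belongs to two of the pairs in `s`, and the entries of each pair differ. -/
def PairsDisjoint (s : Finset (X × X)) : Prop :=
  (∀ z ∈ s, z.1 ≠ z.2) ∧ (s : Set (X × X)).Pairwise fun z z' =>
    z.1 ≠ z'.1 ∧ z.1 ≠ z'.2 ∧ z.2 ≠ z'.1 ∧ z.2 ≠ z'.2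

/-- The pairs are treated one by one. By disjointness, the conditions and weights of the other pairs
are constant along the two registers in play, so they can be absorbed in `W`; hence the
quantification over `W`. -/
theorem exists_record_registers [Nonempty Y] (hY : 8 ≤ Fintype.card Y) (s : Finset (X × X))
    (hs : PairsDisjoint s) : ∃ l : List X, l.Nodup ∧ (∀ x, x ∈ l ↔ ∃ z ∈ s, x = z.1 ∨ x = z.2) ∧
      ∀ (W : (X → Option Y) → ℝ), (∀ D, 0 ≤ W D) →
        (∀ x ∈ l, ∀ D d, W (Function.update D x d) = W D) → ∀ v : (X → Option Y) → ℂ,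
        ∑ D, (if ∀ z ∈ s, Records z D then W D * ‖record Y l v D‖ ^ 2 else 0) ≤
          ∑ D, W D * (∏ z ∈ s, recordWeight z D) * ‖v D‖ ^ 2 := by
  induction s using Finset.induction_on with
  | empty => exact ⟨[], List.nodup_nil, by simp, fun W _ _ v => by simp [record]⟩
  | insert z s hzs ih =>
    obtain ⟨hne, hpw⟩ := hs
    have hdis : ∀ z' ∈ s, z.1 ≠ z'.1 ∧ z.1 ≠ z'.2 ∧ z.2 ≠ z'.1 ∧ z.2 ≠ z'.2 := fun z' hz' =>
      hpw (by simp) (by simp [hz']) fun h => hzs (h ▸ hz')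
    have hz : z.1 ≠ z.2 := hne z (by simp)
    obtain ⟨l, hl, hmem, hW⟩ := ih ⟨fun z' hz' => hne z' (by simp [hz']),
      hpw.mono (by simp)⟩
    have h1 : z.1 ∉ l := fun h => by
      obtain ⟨z', hz', h | h⟩ := (hmem _).1 h
      exacts [(hdis z' hz').1 h, (hdis z' hz').2.1 h]
    have h2 : z.2 ∉ l := fun h => by
      obtain ⟨z', hz', h | h⟩ := (hmem _).1 h
      exacts [(hdis z' hz').2.2.1 h, (hdis z' hz').2.2.2 h]
    refine ⟨z.1 :: z.2 :: l, ?_, ?_, ?_⟩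
    · simp [hz, h1, h2, hl]
    · intro x
      simp [hmem, or_assoc]
    · intro W hW0 hWl v
      have key := sum_records_norm_sq_le hY hz
        (W := fun D => if ∀ z' ∈ s, Records z' D then W D else 0)
        (fun D => by split_ifs; exacts [hW0 D, le_rfl])
        (fun D d => by
          rw [hWl z.1 (by simp)]
          refine if_congr (forall₂_congr fun z' hz' => ?_) rfl rfl
          exact records_update_iff (hdis z' hz').1 (hdis z' hz').2.1 D d)
        (fun D d => by
          rw [hWl z.2 (by simp)]
          refine if_congr (forall₂_congr fun z' hz' => ?_) rfl rfl
          exact records_update_iff (hdis z' hz').2.2.1 (hdis z' hz').2.2.2 D d)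
        (record Y l v)
      have key2 := hW (fun D => W D * recordWeight z D)
        (fun D => mul_nonneg (hW0 D) (recordWeight_nonneg z D))
        (fun x hx D d => by
          rw [hWl x (by simp [hx])]
          rw [recordWeight_update (ne_of_mem_of_not_mem hx h1) (ne_of_mem_of_not_mem hx h2)]) v
      calc _ = _ := Finset.sum_congr rfl fun D _ => ?_
        _ ≤ _ := key
        _ = _ := Finset.sum_congr rfl fun D _ => ?_
        _ ≤ _ := key2
        _ = _ := Finset.sum_congr rfl fun D _ => ?_
      · simp only [Finset.forall_mem_insert, record_cons, Module.End.mul_apply, ite_and, ite_mul,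
          zero_mul]
      · split_ifs <;> simp
      · rw [Finset.prod_insert hzs]
        ring

/-- The condition ignores the registers outside the pairs, and the exchanges there, applied last,
preserve norms. -/
theorem sum_forall_records_norm_sq_le [Nonempty Y] (hY : 8 ≤ Fintype.card Y) {s : Finset (X × X)}
    (hs : PairsDisjoint s) {l : List X} (hl : l.Nodup) (hmem : ∀ x, x ∈ l)
    (v : (X → Option Y) → ℂ) :
    ∑ D, (if ∀ z ∈ s, Records z D then ‖record Y l v D‖ ^ 2 else 0) ≤
      ∑ D, (∏ z ∈ s, recordWeight z D) * ‖v D‖ ^ 2 := by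
  obtain ⟨l', hl', hmem', h⟩ := exists_record_registers hY s hs
  have hperm : l.Perm (l.filter (· ∉ l') ++ l') := by
    rw [List.perm_ext_iff_of_nodup hl]
    · intro x
      by_cases hx : x ∈ l' <;> simp [hx, hmem]
    · rw [List.nodup_append]
      refine ⟨hl.filter _, hl', fun x hx y hy => ?_⟩
      rintro rfl
      simp [hy] at hx
  rw [record_perm hperm, record_append]
  have h1 := sum_norm_sq_record_le (l.filter (· ∉ l'))
    (W := fun D : X → Option Y => if ∀ z ∈ s, Records z D then 1 else 0)
    (fun D => by split_ifs <;> simp) (fun x hx D d => by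
      refine if_congr (forall₂_congr fun z hz => ?_) rfl rfl
      have hx' : x ∉ l' := by simpa using (List.mem_filter.1 hx).2
      exact records_update_iff (fun hxz => hx' ((hmem' x).2 ⟨z, hz, Or.inl hxz⟩))
        (fun hxz => hx' ((hmem' x).2 ⟨z, hz, Or.inr hxz⟩)) D d) (record Y l' v)
  have h2 := h (fun _ => 1) (fun _ => zero_le_one) (fun _ _ _ _ => rfl) v
  simp only [ite_mul, one_mul, zero_mul] at h1 h2
  exact h1.trans h2

/-- Deleting the second register of each recorded pair loses no value, since the first register
keeps it. So every recorded pair adds one to the surplus. -/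
theorem card_filter_records_lt {s : Finset (X × X)} (hs : PairsDisjoint s) {k : ℕ}
    {D : X → Option Y} (hD : ¬ Surplus k D) : (s.filter fun z => Records z D).card < k := by
  set c := s.filter fun z => Records z D with hc
  have hinj : Set.InjOn Prod.snd (c : Set (X × X)) := by
    intro z hz z' hz' h
    by_contra hne
    exact (hs.2 (Finset.mem_filter.1 hz).1 (Finset.mem_filter.1 hz').1 hne).2.2.2 h
  set dom := Finset.univ.filter fun x => D x ≠ none with hdom
  have hsub : c.image Prod.snd ⊆ dom := by
    intro x hx
    obtain ⟨z, hz, rfl⟩ := Finset.mem_image.1 hx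
    have := (Finset.mem_filter.1 hz).2
    simp only [hdom, Finset.mem_filter, Finset.mem_univ, true_and]
    rw [← this.1]
    exact this.2
  have hval : (values D).map ⟨some, Option.some_injective _⟩ ⊆ (dom \ c.image Prod.snd).image D := by
    intro d hd
    obtain ⟨y, hy, rfl⟩ := Finset.mem_map.1 hd
    obtain ⟨x, hx⟩ := mem_values.1 hy
    rw [Finset.mem_image]
    by_cases hxc : x ∈ c.image Prod.snd
    · obtain ⟨z, hz, rfl⟩ := Finset.mem_image.1 hxc
      have hzD := (Finset.mem_filter.1 hz).2
      refine ⟨z.1, ?_, hzD.1.trans hx⟩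
      refine Finset.mem_sdiff.2 ⟨by simpa [hdom] using hzD.2, fun h => ?_⟩
      obtain ⟨z', hz', h'⟩ := Finset.mem_image.1 h
      rcases eq_or_ne z' z with rfl | hne
      · exact hs.1 _ (Finset.mem_filter.1 hz).1 h'.symm
      · exact (hs.2 (Finset.mem_filter.1 hz').1 (Finset.mem_filter.1 hz).1 hne).2.2.1 h'
    · exact ⟨x, Finset.mem_sdiff.2 ⟨by simp [hdom, hx], hxc⟩, hx⟩
  have h1 : (values D).card ≤ (dom \ c.image Prod.snd).card := by
    rw [← Finset.card_map ⟨some, Option.some_injective Y⟩]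
    exact (Finset.card_le_card hval).trans Finset.card_image_le
  rw [Finset.card_sdiff_of_subset hsub, Finset.card_image_of_injOn hinj] at h1
  have h2 := Finset.card_le_card hsub
  rw [Finset.card_image_of_injOn hinj] at h2
  have h3 : domSize D = dom.card := rfl
  unfold Surplus at hD
  omega

theorem prod_recordWeight_le [Nonempty Y] (hY : 8 ≤ Fintype.card Y) {s : Finset (X × X)}
    {k : ℕ} (hcard : s.card + 1 = 2 * k) (D : X → Option Y) :
    ∏ z ∈ s, recordWeight z D ≤ 64 ^ k := by
  have hn : (8 : ℝ) ≤ Fintype.card Y := by exact_mod_cast hY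
  have h8 : ∀ z ∈ s, recordWeight z D ≤ 8 := fun z _ => by
    unfold recordWeight
    split_ifs
    · exact le_rfl
    · rw [div_le_iff₀ (by linarith)]; linarith
  refine (Finset.prod_le_prod (fun z _ => recordWeight_nonneg z D) h8).trans ?_
  rw [Finset.prod_const]
  calc (8 : ℝ) ^ s.card ≤ 8 ^ (2 * k) := pow_le_pow_right₀ (by norm_num) (by omega)
    _ = _ := by rw [pow_mul]; norm_num

/-- Fewer than `k` of the `2 * k - 1` pairs are recorded, so at least `k` factors are `32 / n`. The
other `k - 1` are at most `8`, and `8 * 32 = 256`. -/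
theorem prod_recordWeight_le_of_not_surplus [Nonempty Y] (hY : 8 ≤ Fintype.card Y)
    {s : Finset (X × X)} (hs : PairsDisjoint s) {k : ℕ} (hcard : s.card + 1 = 2 * k)
    {D : X → Option Y} (hD : ¬ Surplus k D) :
    ∏ z ∈ s, recordWeight z D ≤ (256 / Fintype.card Y) ^ k := by
  have hn : (8 : ℝ) ≤ Fintype.card Y := by exact_mod_cast hY
  have hlt := card_filter_records_lt hs hD
  have hsum := Finset.card_filter_add_card_filter_not (s := s) (fun z => Records z D)
  set j := (s.filter fun z => Records z D).card
  have h32 : 32 / (Fintype.card Y : ℝ) ≤ 8 := by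
    rw [div_le_iff₀ (by linarith)]; linarith
  simp only [recordWeight]
  rw [Finset.prod_ite, Finset.prod_const, Finset.prod_const]
  obtain ⟨i, hi⟩ : ∃ i, (s.filter fun z => ¬ Records z D).card = k + i ∧ j + i ≤ k :=
    ⟨(s.filter fun z => ¬ Records z D).card - k, by omega, by omega⟩
  rw [hi.1, pow_add]
  calc (8 : ℝ) ^ j * ((32 / (Fintype.card Y : ℝ)) ^ k * (32 / (Fintype.card Y : ℝ)) ^ i)
      ≤ 8 ^ j * ((32 / (Fintype.card Y : ℝ)) ^ k * 8 ^ i) := by gcongr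
    _ = 8 ^ (j + i) * (32 / (Fintype.card Y : ℝ)) ^ k := by ring
    _ ≤ 8 ^ k * (32 / (Fintype.card Y : ℝ)) ^ k := by
        gcongr
        · norm_num
        · exact hi.2
    _ = _ := by rw [← mul_pow]; congr 1; ring

end Collisions

/-! ### Circuits with few queries. -/

noncomputable section CircuitBound

theorem trace_vecMulVec_star_re {n : Type*} [Fintype n] (v : n → ℂ) :
    (Matrix.vecMulVec v (star v)).trace.re = ∑ b, ‖v b‖ ^ 2 := by
  rw [Matrix.trace, Complex.re_sum]
  refine Finset.sum_congr rfl fun b _ => ?_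
  rw [Matrix.diag_apply, Matrix.vecMulVec_apply, Pi.star_apply, Complex.star_def, Complex.mul_conj']
  norm_cast

theorem mul_vecMulVec_star_mul_conjTranspose {n : Type*} [Fintype n] (E : Matrix n n ℂ) (v : n → ℂ) :
    E * Matrix.vecMulVec v (star v) * Eᴴ = Matrix.vecMulVec (E *ᵥ v) (star (E *ᵥ v)) := by
  rw [Matrix.mul_vecMulVec, Matrix.vecMulVec_mul, Matrix.star_mulVec]

theorem sum_sum_norm_sq_mulVec {n ι : Type*} [Fintype n] [DecidableEq n] [Fintype ι]
    (E : ι → Matrix n n ℂ) (hE : ∑ i, (E i)ᴴ * E i = 1) (v : n → ℂ) :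
    ∑ i, ∑ b, ‖(E i *ᵥ v) b‖ ^ 2 = ∑ b, ‖v b‖ ^ 2 := by
  rw [← trace_vecMulVec_star_re v, ← trace_mul_conjTranspose_sum E hE, Matrix.trace_sum,
    Complex.re_sum]
  simp only [mul_vecMulVec_star_mul_conjTranspose, trace_vecMulVec_star_re]

/-- An operation on the memory commutes with `V`, which acts on the database, and keeps the total
weight on each database. The Kraus index joins the family, so every branch stays pure. -/
theorem ProgressBound.kraus {X Y : Type*} [Fintype X] [DecidableEq X] [Fintype Y] [DecidableEq Y]
    {I n ι : Type*} [Fintype I] [Fintype n] [DecidableEq n] [Fintype ι] {t : ℕ} {ε α : ℝ}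
    (V : Module.End ℂ ((X → Option Y) → ℂ)) (E : ι → Matrix n n ℂ)
    (hE : ∑ i, (E i)ᴴ * E i = 1) (ψ : I → n → (X → Option Y) → ℂ)
    (h : ProgressBound t ε α fun p : I × n => V (ψ p.1 p.2)) :
    ProgressBound t ε α fun p : (I × ι) × n =>
      V (fun D => (E p.1.2 *ᵥ fun b => ψ p.1.1 b D) p.2) := by
  have hV : ∀ i j b, V (fun D => (E j *ᵥ fun b => ψ i b D) b) =
      fun D => (E j *ᵥ fun b => V (ψ i b) D) b := by
    intro i j b
    have : (fun D => (E j *ᵥ fun b => ψ i b D) b) = ∑ b', E j b b' • ψ i b' := by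
      funext D
      simp [Matrix.mulVec, dotProduct, Finset.sum_apply]
    rw [this, map_sum]
    funext D
    simp [Matrix.mulVec, dotProduct, Finset.sum_apply]
  simp only [hV]
  refine ⟨fun p D hD => ?_, fun k => ?_⟩
  · obtain ⟨b, -, hb⟩ := Finset.exists_ne_zero_of_sum_ne_zero hD
    exact h.1 (p.1.1, b) D (right_ne_zero_of_mul hb)
  · refine le_trans (le_of_eq ?_) (h.2 k)
    simp only [Fintype.sum_prod_type]
    refine Finset.sum_congr rfl fun i _ => ?_
    have hcomm : ∀ g : n → (X → Option Y) → ℝ, ∑ b, ∑ D, g b D = ∑ D, ∑ b, g b D :=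
      fun g => Finset.sum_comm
    simp only [hcomm]
    rw [Finset.sum_comm]
    refine Finset.sum_congr rfl fun D _ => ?_
    by_cases hD : Surplus k D
    · simp only [hD, if_true]
      exact sum_sum_norm_sq_mulVec E hE _
    · simp [hD]

variable {M N S : ℕ}

theorem sum_some_comp_le {h : (Fin M → Option (Fin N)) → ℝ} (hh : ∀ D, 0 ≤ h D) :
    ∑ f : Fin M → Fin N, h (fun x => some (f x)) ≤ ∑ D, h D := by
  have hinj : Function.Injective fun (f : Fin M → Fin N) (x : Fin M) => some (f x) :=
    fun f g hfg => funext fun x => Option.some_injective _ (congrFun hfg x)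
  refine (Finset.sum_map Finset.univ ⟨_, hinj⟩ h).symm.trans_le ?_
  exact Finset.sum_le_sum_of_subset_of_nonneg (Finset.subset_univ _) fun D _ _ => hh D

open Classical in
-- If some `f₀` makes `out` correct, it supplies `K` disjoint pairs of `out`. These do not depend on
-- `f`, and all of them must be collisions whenever `f` succeeds.
theorem sum_finds_norm_sq_le (hN : 8 ≤ N) {K k : ℕ} (hK : K + 1 = 2 * k)
    (out : List (Fin M × Fin M)) (v : (Fin M → Option (Fin N)) → ℂ) :
    ∑ f : Fin M → Fin N,
      (if FindsDisjointCollisions K f out then ‖v fun x => some (f x)‖ ^ 2 else 0) ≤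
    64 ^ k * ∑ D, (if Surplus k D then ‖record (Fin N) (List.finRange M) v D‖ ^ 2 else 0) +
      (256 / N) ^ k * ∑ D, ‖record (Fin N) (List.finRange M) v D‖ ^ 2 := by
  have : Nonempty (Fin N) := ⟨⟨0, by omega⟩⟩
  have hY : 8 ≤ Fintype.card (Fin N) := by simpa using hN
  set w := record (Fin N) (List.finRange M) v with hw
  have hv : v = record (Fin N) (List.finRange M) w := by
    rw [hw, ← Module.End.mul_apply, record_mul_self (List.nodup_finRange M), Module.End.one_apply]
  by_cases hex : ∃ f : Fin M → Fin N, FindsDisjointCollisions K f out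
  · obtain ⟨f₀, h1, s, hsK, hso, hsp⟩ := hex
    have hs : PairsDisjoint s := ⟨fun z hz => (h1 z (hso z hz)).1, hsp⟩
    calc _ ≤ ∑ f : Fin M → Fin N, (if ∀ z ∈ s, Records z fun x => some (f x) then
            ‖v fun x => some (f x)‖ ^ 2 else 0) := by
          refine Finset.sum_le_sum fun f _ => ?_
          split_ifs with hf hf'
          · exact le_rfl
          · exact absurd (fun z hz => ⟨congrArg some (hf.1 z (hso z hz)).2, by simp⟩) hf'
          · positivity
          · exact le_rfl
      _ ≤ ∑ D : Fin M → Option (Fin N), (if ∀ z ∈ s, Records z D then ‖v D‖ ^ 2 else 0) :=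
          sum_some_comp_le (h := fun D => if ∀ z ∈ s, Records z D then ‖v D‖ ^ 2 else 0)
            fun D => by split_ifs <;> positivity
      _ ≤ ∑ D, (∏ z ∈ s, recordWeight z D) * ‖w D‖ ^ 2 := by
          have := sum_forall_records_norm_sq_le hY hs (List.nodup_finRange M) List.mem_finRange w
          rw [hv]
          convert this
      _ ≤ ∑ D, (64 ^ k * (if Surplus k D then ‖w D‖ ^ 2 else 0) +
            (256 / N) ^ k * ‖w D‖ ^ 2) := by
          refine Finset.sum_le_sum fun D _ => ?_
          split_ifs with hD
          · refine (mul_le_mul_of_nonneg_right (prod_recordWeight_le hY (by rw [hsK, hK]) D)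
              (by positivity)).trans (le_add_of_nonneg_right (by positivity))
          · have := prod_recordWeight_le_of_not_surplus hY hs (by rw [hsK, hK]) hD
            rw [Fintype.card_fin] at this
            rw [mul_zero, zero_add]
            exact mul_le_mul_of_nonneg_right this (by positivity)
      _ = _ := by rw [Finset.sum_add_distrib, ← Finset.mul_sum, ← Finset.mul_sum]
  · push Not at hex
    simp only [hex, if_false, Finset.sum_const_zero]
    have : 0 ≤ ∑ D, (if Surplus k D then ‖w D‖ ^ 2 else 0) :=
      Finset.sum_nonneg fun D _ => by split_ifs <;> positivity
    positivity

/-- The oracle gate on the amplitudes of all databases. -/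
def oracleStep (e : Fin (Nat.clog 2 M) ⊕ Fin (Nat.clog 2 N) ↪ Fin S) (b : BasisState S)
    (v : (Fin M → Option (Fin N)) → ℂ) : (Fin M → Option (Fin N)) → ℂ :=
  if h : wireValue (fun i => e (Sum.inl i)) b < M ∧ wireValue (fun i => e (Sum.inr i)) b < N then
    localOp (⟨wireValue (fun i => e (Sum.inl i)) b, h.1⟩ : Fin M)
      (Matrix.diagonal fun d : Option (Fin N) => d.elim 0 fun y =>
        Complex.exp (2 * (Real.pi : ℂ) * Complex.I / (N : ℂ)) ^
          (wireValue (fun i => e (Sum.inr i)) b * (y : ℕ))) v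
  else v

theorem oracleStep_some (e : Fin (Nat.clog 2 M) ⊕ Fin (Nat.clog 2 N) ↪ Fin S) (b : BasisState S)
    (v : (Fin M → Option (Fin N)) → ℂ) (f : Fin M → Fin N) :
    oracleStep e b v (fun x => some (f x)) = oraclePhase e f b * v fun x => some (f x) := by
  unfold oracleStep oraclePhase
  split_ifs with h
  · rw [localOp_apply, Finset.sum_eq_single (some (f ⟨_, h.1⟩))]
    · rw [Matrix.diagonal_apply_eq, Option.elim_some]
      congr 2
      exact Function.update_eq_self _ _
    · intro d _ hd
      rw [Matrix.diagonal_apply_ne' _ hd, zero_mul]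
    · simp
  · rw [one_mul]

theorem record_oracleStep (hN : 0 < N) (e : Fin (Nat.clog 2 M) ⊕ Fin (Nat.clog 2 N) ↪ Fin S)
    (b : BasisState S) (v : (Fin M → Option (Fin N)) → ℂ) :
    record (Fin N) (List.finRange M) (oracleStep e b v) = record (Fin N) (List.finRange M) v ∨
      ∃ (x : Fin M) (u : Fin N → ℂ), (∀ y, ‖u y‖ ≤ 1) ∧
        record (Fin N) (List.finRange M) (oracleStep e b v) =
          localOp x (phaseMatrix u) (record (Fin N) (List.finRange M) v) := by
  have : Nonempty (Fin N) := ⟨⟨0, hN⟩⟩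
  unfold oracleStep
  split_ifs with h
  · refine Or.inr ⟨⟨_, h.1⟩, _, fun y =>
      (norm_exp_root_pow N (wireValue (fun i => e (Sum.inr i)) b * (y : ℕ))).le, ?_⟩
    rw [← Module.End.mul_apply, record_mul_localOp (List.nodup_finRange M) (List.mem_finRange _)]
    rfl
  · exact Or.inl rfl

open Classical in
/-- The success probability of a circuit with few queries on a family of pure states that
depend on `f` only through what is recorded in a database. -/
theorem sum_outputProb_le_of_progressBound (hN : 8 ≤ N) {K k T : ℕ} (hK : K + 1 = 2 * k)
    {ε α : ℝ} (hε0 : 0 ≤ ε) (hα : 0 ≤ α) (hε : 13 * T / N ≤ ε ^ 2) (C : OracleCircuit M N S)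
    (I : Type) [Fintype I] (ψ : I → BasisState S → (Fin M → Option (Fin N)) → ℂ)
    (o : I → List (Fin M × Fin M)) (t : ℕ) (ht : t + C.queryCount ≤ T)
    (hψ : ProgressBound t ε α fun p : I × BasisState S =>
      record (Fin N) (List.finRange M) (ψ p.1 p.2)) :
    ∑ f : Fin M → Fin N, ∑ i, outputProb f (FindsDisjointCollisions K f) C
      (Matrix.vecMulVec (fun b => ψ i b fun x => some (f x))
        (star fun b => ψ i b fun x => some (f x))) (o i) ≤
      64 ^ k * (T.choose k * ε ^ k * α) ^ 2 + (256 / N) ^ k * α ^ 2 := by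
  induction C generalizing I t with
  | nil =>
    simp only [outputProb, trace_vecMulVec_star_re]
    calc _ = ∑ i, ∑ b, ∑ f : Fin M → Fin N, (if FindsDisjointCollisions K f (o i) then
            ‖ψ i b fun x => some (f x)‖ ^ 2 else 0) := by
          rw [Finset.sum_comm]
          refine Finset.sum_congr rfl fun i _ => ?_
          rw [Finset.sum_comm]
          refine Finset.sum_congr rfl fun f _ => ?_
          split_ifs <;> simp
      _ ≤ ∑ i, ∑ b, (64 ^ k * ∑ D, (if Surplus k D then
              ‖record (Fin N) (List.finRange M) (ψ i b) D‖ ^ 2 else 0) +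
            (256 / N) ^ k * ∑ D, ‖record (Fin N) (List.finRange M) (ψ i b) D‖ ^ 2) :=
          Finset.sum_le_sum fun i _ => Finset.sum_le_sum fun b _ =>
            sum_finds_norm_sq_le hN hK (o i) (ψ i b)
      _ ≤ 64 ^ k * (t.choose k * ε ^ k * α) ^ 2 + (256 / N) ^ k * α ^ 2 := by
          have h0 := hψ.2 0
          have hk := hψ.2 k
          simp only [surplus_zero, if_true, Nat.choose_zero_right, pow_zero, Nat.cast_one,
            one_mul] at h0
          rw [Fintype.sum_prod_type] at h0 hk
          simp only [Finset.sum_add_distrib, ← Finset.mul_sum]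
          gcongr
      _ ≤ _ := by
          have : (t.choose k : ℝ) ≤ T.choose k := by
            exact_mod_cast Nat.choose_le_choose k (by omega)
          gcongr
  | cons g C ih =>
    cases g with
    | operation κ E hE =>
      have := ih (I × Fin κ) (fun p b D => (E p.2 *ᵥ fun b => ψ p.1 b D) b) (fun p => o p.1) t
        (by simpa [OracleCircuit.queryCount, OracleGate.isQuery] using ht)
        (hψ.kraus _ E hE ψ)
      refine le_trans (le_of_eq ?_) this
      refine Finset.sum_congr rfl fun f _ => ?_
      rw [Fintype.sum_prod_type]
      refine Finset.sum_congr rfl fun i _ => ?_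
      rw [outputProb, outputProb_sum]
      simp only [mul_vecMulVec_star_mul_conjTranspose]
    | query e =>
      have hNpos : Nonempty (Fin N) := ⟨⟨0, by omega⟩⟩
      have htq : t + (OracleCircuit.queryCount C + 1) ≤ T := by
        simpa [OracleCircuit.queryCount, OracleGate.isQuery, List.countP_cons] using ht
      have hle : 13 * (t : ℝ) / Fintype.card (Fin N) ≤ ε ^ 2 := by
        refine le_trans ?_ hε
        rw [Fintype.card_fin]
        have : (t : ℝ) ≤ T := by exact_mod_cast (by omega : t ≤ T)
        gcongr
      have := ih I (fun i b => oracleStep e b (ψ i b)) o (t + 1) (by omega)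
        (hψ.query hα hε0 hle fun p => record_oracleStep (by omega) e p.2 (ψ p.1 p.2))
      refine le_trans (le_of_eq ?_) this
      refine Finset.sum_congr rfl fun f _ => Finset.sum_congr rfl fun i _ => ?_
      rw [outputProb, mul_vecMulVec_star_mul_conjTranspose]
      have hv : (oracleMatrix e f *ᵥ fun b => ψ i b fun x => some (f x)) =
          fun b => oracleStep e b (ψ i b) fun x => some (f x) := by
        funext b
        rw [oracleStep_some, oracleMatrix, Matrix.mulVec_diagonal]
      rw [hv]
    | output r =>
      -- An output gate is a measurement: a Kraus family of projectors whose outcome extends the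
      -- list of the branch.
      have := ih (I × Option (Fin M × Fin M))
        (fun p b D => (outputProjector r p.2 *ᵥ fun b => ψ p.1 b D) b)
        (fun p => o p.1 ++ p.2.toList) t
        (by simpa [OracleCircuit.queryCount, OracleGate.isQuery] using ht)
        (hψ.kraus _ _ (sum_outputProjector_mul r) ψ)
      refine le_trans (le_of_eq ?_) this
      refine Finset.sum_congr rfl fun f _ => ?_
      rw [Fintype.sum_prod_type]
      refine Finset.sum_congr rfl fun i _ => ?_
      rw [outputProb]
      refine Finset.sum_congr rfl fun p _ => ?_
      rw [← mul_vecMulVec_star_mul_conjTranspose, outputProjector_conjTranspose]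

theorem uniformState_some (f : Fin M → Fin N) :
    uniformState (Fin M) (Fin N) (fun x => some (f x)) = ((((√N)⁻¹ ^ M : ℝ)) : ℂ) := by
  simp [uniformState]

/-- The recorded database is empty, so it has surplus zero; the square of the amplitude bound counts
the starting states. -/
theorem progressBound_uniformState (hN : 0 < N) {I : Type} [Fintype I] (β : I → BasisState S)
    (ε : ℝ) : ProgressBound 0 ε (√(Fintype.card I)) fun p : I × BasisState S =>
      record (Fin N) (List.finRange M) (if p.2 = β p.1 then uniformState (Fin M) (Fin N) else 0) := by
  classical
  have : Nonempty (Fin N) := ⟨⟨0, hN⟩⟩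
  have hrec : ∀ p : I × BasisState S, record (Fin N) (List.finRange M)
      (if p.2 = β p.1 then uniformState (Fin M) (Fin N) else 0) =
      fun D => if p.2 = β p.1 ∧ D = fun _ => none then 1 else 0 := by
    intro p
    split_ifs with h
    · rw [record_uniformState (List.nodup_finRange M) List.mem_finRange]
      simp [h, funext_iff]
    · rw [map_zero]
      simp [h, Pi.zero_def]
  have hdom : domSize (fun _ => none : Fin M → Option (Fin N)) = 0 := by simp [domSize]
  simp only [hrec]
  refine ⟨fun p D hD => ?_, fun k => ?_⟩
  · simp only [ne_eq, ite_eq_right_iff, one_ne_zero, imp_false, not_not] at hD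
    rw [hD.2, hdom]
  · cases k with
    | zero =>
      simp only [surplus_zero, if_true, Nat.choose_zero_right, pow_zero, Nat.cast_one, one_mul,
        Real.sq_sqrt (Nat.cast_nonneg _), Fintype.sum_prod_type, ite_and]
      simp [apply_ite]
    | succ k =>
      refine le_of_eq_of_le ?_ (sq_nonneg _)
      refine Finset.sum_eq_zero fun p _ => Finset.sum_eq_zero fun D _ => ?_
      by_cases hD : p.2 = β p.1 ∧ D = fun _ => none
      · rw [if_neg]
        rw [hD.2, Surplus, hdom]
        omega
      · simp [hD]

/-- A circuit with at most `T` queries that starts in one of `card I` basis states, independently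
of the random function, is unlikely to find `2 * k - 1` disjoint collisions. -/
theorem sum_outputProb_le (hN : 8 ≤ N) {K k T : ℕ} (hK : K + 1 = 2 * k) (C : OracleCircuit M N S)
    (hC : C.queryCount ≤ T) {I : Type} [Fintype I] (β : I → BasisState S) :
    ∑ f : Fin M → Fin N, outputProb f (FindsDisjointCollisions K f) C
      (∑ i, Matrix.single (β i) (β i) 1) [] ≤
      (N : ℝ) ^ M * (Fintype.card I *
        (64 ^ k * ((T.choose k : ℝ) ^ 2 * (13 * T / N) ^ k) + (256 / N) ^ k)) := by
  have hN0 : (0 : ℝ) < N := by exact_mod_cast (by omega : 0 < N)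
  have key := sum_outputProb_le_of_progressBound hN hK (T := T) (Real.sqrt_nonneg (13 * T / N))
    (Real.sqrt_nonneg (Fintype.card I)) (Real.sq_sqrt (by positivity)).ge C I
    (fun i b => if b = β i then uniformState (Fin M) (Fin N) else 0) (fun _ => []) 0 (by omega)
    (progressBound_uniformState (by omega) β _)
  -- Each `f` has squared amplitude `(N ^ M)⁻¹` in the uniform state, which is the average over
  -- random functions.
  have hvec : ∀ (i : I) (f : Fin M → Fin N), Matrix.vecMulVec
      (fun b => (if b = β i then uniformState (Fin M) (Fin N) else 0) fun x => some (f x))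
      (star fun b => (if b = β i then uniformState (Fin M) (Fin N) else 0) fun x => some (f x)) =
      ((((N : ℝ) ^ M)⁻¹ : ℝ) : ℂ) • Matrix.single (β i) (β i) 1 := by
    intro i f
    have hsq : ((((√N)⁻¹ ^ M : ℝ)) : ℂ) * ((((√N)⁻¹ ^ M : ℝ)) : ℂ) =
        ((((N : ℝ) ^ M)⁻¹ : ℝ) : ℂ) := by
      rw [← Complex.ofReal_mul, ← mul_pow, ← mul_inv, Real.mul_self_sqrt hN0.le, inv_pow]
    ext b b'
    rw [Matrix.vecMulVec_apply, Matrix.smul_apply, Matrix.single_apply, ← hsq]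
    by_cases h : b = β i <;> by_cases h' : b' = β i
    · simp only [h, h', if_true, Pi.star_apply, uniformState_some, Complex.star_def,
        Complex.conj_ofReal, and_self, smul_eq_mul, mul_one]
    · simp [h, h', Ne.symm h']
    · simp [h, h', Ne.symm h]
    · simp [h, h', Ne.symm h]
  simp only [hvec, outputProb_smul, ← Finset.mul_sum, ← outputProb_sum] at key
  rw [inv_mul_le_iff₀ (by positivity)] at key
  refine key.trans_eq ?_
  rw [mul_pow, mul_pow, ← pow_mul, mul_comm k 2, pow_mul, Real.sq_sqrt (by positivity),
    Real.sq_sqrt (by positivity)]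
  ring

end CircuitBound

/-! ### Numerical estimates and choice of the parameters. -/

theorem choose_le_three_mul_div_pow (T k : ℕ) (hk : 0 < k) :
    (T.choose k : ℝ) ≤ (3 * T / k) ^ k := by
  have hk' : (0 : ℝ) < k := by exact_mod_cast hk
  have h1 : (T.choose k : ℝ) ≤ T ^ k / k.factorial := Nat.choose_le_pow_div k T
  have h2 : (k : ℝ) ^ k / k.factorial ≤ 3 ^ k := by
    calc (k : ℝ) ^ k / k.factorial ≤ Real.exp k := Real.pow_div_factorial_le_exp _ hk'.le k
      _ = Real.exp 1 ^ k := by rw [← Real.exp_nat_mul, mul_one]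
      _ ≤ 3 ^ k := pow_le_pow_left₀ (Real.exp_pos _).le (by linarith [Real.exp_one_lt_d9]) k
  refine h1.trans ?_
  calc (T : ℝ) ^ k / k.factorial = (T / k) ^ k * ((k : ℝ) ^ k / k.factorial) := by
        rw [div_pow]; field_simp
    _ ≤ (T / k) ^ k * 3 ^ k := by gcongr
    _ = _ := by rw [← mul_pow]; congr 1; ring

/-- The constants are `239616 = 32 * (64 * 9 * 13)` and `8192 = 32 * 256`. The rate `1 / 32` leaves
room for two factors `2 ^ S`: the starting states and the number of blocks. -/
theorem collision_bound_le {N k T : ℕ} (hk : 0 < k) (hN : 8192 ≤ N)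
    (hT : 239616 * (T : ℝ) ^ 3 ≤ (k : ℝ) ^ 2 * N) :
    64 ^ k * ((T.choose k : ℝ) ^ 2 * (13 * T / N) ^ k) + (256 / (N : ℝ)) ^ k ≤
      2 * (1 / 32) ^ k := by
  have hk' : (0 : ℝ) < k := by exact_mod_cast hk
  have hN' : (8192 : ℝ) ≤ N := by exact_mod_cast hN
  have hN0 : (0 : ℝ) < N := by linarith
  have h1 : 64 ^ k * ((T.choose k : ℝ) ^ 2 * (13 * T / N) ^ k) ≤ (1 / 32) ^ k := by
    calc 64 ^ k * ((T.choose k : ℝ) ^ 2 * (13 * T / N) ^ k)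
        ≤ 64 ^ k * (((3 * T / k) ^ k) ^ 2 * (13 * T / N) ^ k) := by
          gcongr
          exact choose_le_three_mul_div_pow T k hk
      _ = (7488 * (T : ℝ) ^ 3 / (k ^ 2 * N)) ^ k := by
          rw [← pow_mul, mul_comm k 2, pow_mul, ← mul_pow, ← mul_pow]
          congr 1
          field_simp
          ring
      _ ≤ (1 / 32) ^ k := by
          refine pow_le_pow_left₀ (by positivity) ?_ k
          rw [div_le_div_iff₀ (by positivity) (by norm_num)]
          linarith
  have h2 : (256 / (N : ℝ)) ^ k ≤ (1 / 32) ^ k := by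
    refine pow_le_pow_left₀ (by positivity) ?_ k
    rw [div_le_div_iff₀ hN0 (by norm_num)]
    linarith
  linarith

/-- The phase register of a query must fit in memory. This bounds the number of blocks, at most `N`,
by `2 ^ S`. -/
theorem OracleCircuit.le_two_pow_of_queryCount_ne_zero {M N S : ℕ} (C : OracleCircuit M N S)
    (h : C.queryCount ≠ 0) : N ≤ 2 ^ S := by
  obtain ⟨g, -, hg⟩ := List.countP_pos_iff.1 (Nat.pos_of_ne_zero h)
  cases g with
  | operation k E hE => simp [OracleGate.isQuery] at hg
  | output r => simp [OracleGate.isQuery] at hg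
  | query e =>
    have := Fintype.card_le_of_embedding e
    simp only [Fintype.card_sum, Fintype.card_fin] at this
    exact (Nat.le_pow_clog one_lt_two N).trans (Nat.pow_le_pow_right two_pos (by omega))

theorem sum_single_eq_one (S : ℕ) :
    ∑ b : BasisState S, Matrix.single b b (1 : ℂ) = 1 := by
  ext b b'
  rw [Matrix.sum_apply, Matrix.one_apply]
  simp [Matrix.single_apply, ite_and]

theorem successProb_le_of_queryCount_eq_zero {K M N S : ℕ} (C : OracleCircuit M N S) (hK : 1 ≤ K)
    (hN : 8 * K ≤ N) (hC : C.queryCount = 0) : C.successProb K ≤ 1 / 8 := by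
  have hN8 : (8 : ℝ) ≤ N := by exact_mod_cast (by omega : 8 ≤ N)
  have h := sum_outputProb_le_of_queryCount_eq_zero hK C hC (initialState_posSemidef S) []
  rw [trace_initialState, mul_one] at h
  rw [OracleCircuit.successProb, div_le_iff₀ (by positivity)]
  have h0 : 0 ≤ ∑ f : Fin M → Fin N,
      outputProb f (FindsDisjointCollisions K f) C (initialState S) [] :=
    Finset.sum_nonneg fun f _ => outputProb_nonneg f _ _ (initialState_posSemidef S) _
  nlinarith

/-- The uncut circuit starts from a fixed state, so no factor `2 ^ S` is lost and `k` need not be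
comparable to `S`. -/
theorem successProb_le_of_few_queries {K M N S k : ℕ} (C : OracleCircuit M N S) (hk : 0 < k)
    (hkK : 2 * k ≤ K + 1) (hN : 8192 ≤ N)
    (hT : 239616 * (C.queryCount : ℝ) ^ 3 ≤ (k : ℝ) ^ 2 * N) : C.successProb K ≤ 1 / 16 := by
  have hN0 : (0 : ℝ) < N := by exact_mod_cast (by omega : 0 < N)
  have h1 := sum_outputProb_le (by omega) (Nat.sub_add_cancel (by omega : 1 ≤ 2 * k)) C le_rfl
    (I := Unit) (fun _ => fun _ => false)
  simp only [Finset.univ_unique, Finset.sum_singleton, Fintype.card_unit, Nat.cast_one,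
    one_mul] at h1
  have h2 : ∑ f : Fin M → Fin N,
      outputProb f (FindsDisjointCollisions K f) C (initialState S) [] ≤
      ∑ f : Fin M → Fin N,
        outputProb f (FindsDisjointCollisions (2 * k - 1) f) C (initialState S) [] :=
    Finset.sum_le_sum fun f _ => outputProb_mono_event f C (initialState_posSemidef S) [] []
      fun l hl => hl.mono (by omega)
  have h3 := collision_bound_le hk hN hT
  have h4 : (1 / 32 : ℝ) ^ k ≤ 1 / 32 := by
    simpa using pow_le_pow_of_le_one (by norm_num : (0 : ℝ) ≤ 1 / 32) (by norm_num) hk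
  rw [OracleCircuit.successProb, div_le_iff₀ (by positivity)]
  refine (h2.trans h1).trans ?_
  rw [mul_comm]
  gcongr
  linarith

theorem successProb_le_of_blocks {K M N S L t : ℕ} (C : OracleCircuit M N S) (hS : 0 < S)
    (hNS : N ≤ 2 ^ S) (hN : 8192 ≤ N) (hLN : L + 1 ≤ N) (hLK : (L + 1) * (2 * S - 2) + 1 ≤ K)
    (hC : C.queryCount ≤ (L + 1) * t) (ht : 239616 * (t : ℝ) ^ 3 ≤ (S : ℝ) ^ 2 * N) :
    C.successProb K ≤ 1 / 4 := by
  have hN0 : (0 : ℝ) < N := by exact_mod_cast (by omega : 0 < N)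
  have h1 : ∀ C' : OracleCircuit M N S, C'.queryCount ≤ t → ∑ f : Fin M → Fin N,
      outputProb f (FindsDisjointCollisions (2 * S - 2 + 1) f) C' 1 [] ≤
      (N : ℝ) ^ M * (2 ^ S * (2 * (1 / 32) ^ S)) := fun C' hC' => by
    have := sum_outputProb_le (by omega) (by omega : 2 * S - 2 + 1 + 1 = 2 * S) C' hC'
      (I := BasisState S) id
    simp only [id, sum_single_eq_one] at this
    refine this.trans ?_
    have hcard : Fintype.card (BasisState S) = 2 ^ S := by simp [BasisState]
    rw [hcard]
    push_cast
    gcongr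
    exact collision_bound_le hS hN ht
  have h2 := sum_outputProb_le_of_blocks t (2 * S - 2) h1 L C hC (initialState_posSemidef S)
    (trace_initialState S)
  have h3 : ∑ f : Fin M → Fin N,
      outputProb f (FindsDisjointCollisions K f) C (initialState S) [] ≤
      ∑ f : Fin M → Fin N, outputProb f
        (FindsDisjointCollisions ((L + 1) * (2 * S - 2) + 1) f) C (initialState S) [] :=
    Finset.sum_le_sum fun f _ => outputProb_mono_event f C (initialState_posSemidef S) [] []
      fun l hl => hl.mono hLK
  rw [OracleCircuit.successProb, div_le_iff₀ (by positivity)]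
  refine (h3.trans h2).trans ?_
  have hL : (L : ℝ) + 1 ≤ 2 ^ S := by exact_mod_cast hLN.trans hNS
  have h8 : (1 / 8 : ℝ) ^ S ≤ 1 / 8 := by
    simpa using pow_le_pow_of_le_one (by norm_num : (0 : ℝ) ≤ 1 / 8) (by norm_num) hS
  calc ((L : ℝ) + 1) * ((N : ℝ) ^ M * (2 ^ S * (2 * (1 / 32) ^ S)))
      ≤ 2 ^ S * ((N : ℝ) ^ M * (2 ^ S * (2 * (1 / 32) ^ S))) := by gcongr
    _ = 2 * (1 / 8) ^ S * (N : ℝ) ^ M := by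
        have : (1 / 8 : ℝ) ^ S = 2 ^ S * 2 ^ S * (1 / 32) ^ S := by
          rw [← mul_pow, ← mul_pow]; norm_num
        rw [this]; ring
    _ ≤ 1 / 4 * (N : ℝ) ^ M := by gcongr; linarith

theorem theorem6p1 :
    ∃ c : ℝ, 0 < c ∧
      ∀ (K M N S T : ℕ) (C : OracleCircuit M N S),
        1 ≤ K → 8 * K ≤ N →
        OracleCircuit.queryCount C = T →
        2 / 3 ≤ OracleCircuit.successProb K C →
        c * ((K : ℝ) ^ 3 * (N : ℝ)) ≤ (T : ℝ) ^ 3 * (S : ℝ) := by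
  -- Chosen to cover `N < 2000000`, where `K ^ 3 * N ≤ 2000000 ^ 4 < 10 ^ 26`.
  refine ⟨1 / 10 ^ 26, by positivity, fun K M N S T C hK hKN hT hsucc => ?_⟩
  subst hT
  set T := C.queryCount with hT
  by_cases hT0 : T = 0
  · linarith [successProb_le_of_queryCount_eq_zero C hK hKN hT0]
  have hNS := C.le_two_pow_of_queryCount_ne_zero hT0
  have hS : 0 < S := Nat.pos_of_ne_zero fun h => by
    rw [h, pow_zero] at hNS
    omega
  have hT1 : (1 : ℝ) ≤ T := by exact_mod_cast Nat.pos_of_ne_zero hT0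
  have hS1 : (1 : ℝ) ≤ S := by exact_mod_cast hS
  have hK1 : (1 : ℝ) ≤ K := by exact_mod_cast hK
  have hKN' : (K : ℝ) ≤ N := by exact_mod_cast (by omega : K ≤ N)
  by_cases hN : N < 2000000
  · have hN' : (N : ℝ) ≤ 2000000 := by exact_mod_cast hN.le
    calc 1 / 10 ^ 26 * ((K : ℝ) ^ 3 * N) ≤ 1 / 10 ^ 26 * (2000000 ^ 3 * 2000000) := by
          gcongr
          exact hKN'.trans hN'
      _ ≤ 1 ^ 3 * 1 := by norm_num
      _ ≤ (T : ℝ) ^ 3 * S := by gcongr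
  rw [not_lt] at hN
  have hN' : (2000000 : ℝ) ≤ N := by exact_mod_cast hN
  by_contra! hlt
  rcases le_or_gt K (4 * S) with hKS | hKS
  · have hKS' : (K : ℝ) ≤ 4 * S := by exact_mod_cast hKS
    have hk : (K : ℝ) ≤ 2 * ((K + 1) / 2 : ℕ) := by exact_mod_cast (by omega : K ≤ 2 * ((K + 1) / 2))
    have h1 : (T : ℝ) ^ 3 * K ≤ 4 * (1 / 10 ^ 26 * ((K : ℝ) ^ 2 * N)) * K := by
      calc (T : ℝ) ^ 3 * K ≤ (T : ℝ) ^ 3 * (4 * S) := by gcongr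
        _ ≤ 4 * (1 / 10 ^ 26 * ((K : ℝ) ^ 3 * N)) := by linarith
        _ = _ := by ring
    have h2 := le_of_mul_le_mul_right h1 (by linarith)
    have h3 : (K : ℝ) ^ 2 * N ≤ 4 * (((K + 1) / 2 : ℕ) ^ 2 * N) := by
      calc (K : ℝ) ^ 2 * N ≤ (2 * ((K + 1) / 2 : ℕ)) ^ 2 * N := by gcongr
        _ = _ := by ring
    have h0 : (0 : ℝ) ≤ ((K + 1) / 2 : ℕ) ^ 2 * N := by positivity
    linarith [successProb_le_of_few_queries C (by omega : 0 < (K + 1) / 2)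
      (by omega : 2 * ((K + 1) / 2) ≤ K + 1) (by omega) (by linarith)]
  -- About `K / (2 * S)` blocks, each with a quota of `2 * S - 1` collisions, the odd number that
  -- corresponds to `k = S`.
  · obtain ⟨L, hL⟩ : ∃ L, K / (2 * S) = L + 1 :=
      Nat.exists_eq_succ_of_ne_zero (Nat.div_pos (by omega) (by omega)).ne'
    have hL1 : 2 * S * (L + 1) ≤ K := hL ▸ Nat.mul_div_le K (2 * S)
    have hL2 : K ≤ 4 * S * (L + 1) := by
      have := Nat.lt_mul_div_succ K (by omega : 0 < 2 * S)
      rw [hL] at this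
      nlinarith
    set q := T / (L + 1) with hq
    have hq1 : (L + 1) * q ≤ T := Nat.mul_div_le T (L + 1)
    have hq2 : T ≤ (L + 1) * (q + 1) := (Nat.lt_mul_div_succ T (Nat.succ_pos L)).le
    have hq3 : (K : ℝ) * q ≤ 4 * S * T := by
      have : K * q ≤ 4 * S * T := by
        calc K * q ≤ 4 * S * (L + 1) * q := Nat.mul_le_mul_right _ hL2
          _ = 4 * S * ((L + 1) * q) := by ring
          _ ≤ _ := Nat.mul_le_mul_left _ hq1
      exact_mod_cast this
    have hq4 : (q : ℝ) ^ 3 ≤ 64 * (1 / 10 ^ 26) * ((S : ℝ) ^ 2 * N) := by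
      have : (K : ℝ) ^ 3 * q ^ 3 ≤ K ^ 3 * (64 * (1 / 10 ^ 26) * ((S : ℝ) ^ 2 * N)) := by
        calc (K : ℝ) ^ 3 * q ^ 3 = ((K : ℝ) * q) ^ 3 := by ring
          _ ≤ (4 * (S : ℝ) * T) ^ 3 := pow_le_pow_left₀ (by positivity) hq3 3
          _ = 64 * (S : ℝ) ^ 2 * ((T : ℝ) ^ 3 * S) := by ring
          _ ≤ 64 * (S : ℝ) ^ 2 * (1 / 10 ^ 26 * ((K : ℝ) ^ 3 * N)) := by gcongr
          _ = _ := by ring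
      exact le_of_mul_le_mul_left this (by positivity)
    -- Rounding the block length up to `q + 1` costs `239616 * 4 = 958464`, below half of the lower
    -- bound `2000000` on `N`.
    have hq5 : ((q : ℝ) + 1) ^ 3 ≤ 4 * (q ^ 3 + 1) := by
      have : (0 : ℝ) ≤ q := Nat.cast_nonneg q
      nlinarith [mul_nonneg (add_nonneg this zero_le_one) (sq_nonneg ((q : ℝ) - 1))]
    have hSN : (N : ℝ) ≤ (S : ℝ) ^ 2 * N := le_mul_of_one_le_left (by linarith) (one_le_pow₀ hS1)
    have hLS : L + 1 ≤ 2 * S * (L + 1) := Nat.le_mul_of_pos_left _ (by omega)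
    have hLK : (L + 1) * (2 * S - 2) + 1 ≤ K := by
      have : (L + 1) * (2 * S - 2) + (L + 1) * 2 = 2 * S * (L + 1) := by
        rw [← mul_add, Nat.sub_add_cancel (by omega), mul_comm]
      omega
    have := successProb_le_of_blocks C hS hNS (by omega) (by omega : L + 1 ≤ N) hLK hq2
      (by push_cast; linarith)
    linarith
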